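/- **Setting.** An instance of the Lovász Local Lemma consists of $n$ bad events with unique identifiers, determined by independent random variables; each bad event has probability at most $p\in(0,1)$. In the dependency graph $G$, two distinct bad events are adjacent if they share a variable, and every bad event has at most $d$ neighbours. A randomness table contains, for each variable $x$, independent samples $x_0,x_1,x_2,\dots$ from its distribution. In the Chung–Pettie–Su algorithm every variable $x$ starts with the value $x_0$; in each round, all bad events that currently hold and have no neighbour in $G$ that currently holds and has a lower identifier resample all their variables, i.e. each of these variables moves on to its next value in the table. Fix constants $\delta>0$ and $c\ge 1$, and assume $p\le d^{-(10+\delta)}$. Asymptotic notation refers to $d\to\infty$ and $\log_{1/p} n\to\infty$ (that is, $d=\omega(1)$ and $p=n^{-o(1)}$). All implied constants and thresholds depend only on $\delta$ and $c$, and "w.h.p." means with probability at least $1-n^{-c}$ over the randomness table. **Lemma (Insecure events).** There is a property of events under a randomness table, called *insecure* (events without it are *secure*), such that: 1. Whether an event is insecure depends only on its $O(\log\log_{1/p} n)$-radius neighbourhood in $G$ (its events, identifiers and variables, and the table entries of these variables; $n$, $p$, $d$ are known globally). 2. W.h.p., no variable of a secure event is resampled after the first $O(\log\log_{1/p} n)$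 rounds. 3. W.h.p., the subgraph $G'$ of $G$ induced by the insecure events has at most $np^{\Omega(\log\log_{1/p} n)}=o(n)$ nodes and at most $np^{\Omega(\log\log_{1/p} n)}=o(n)$ edges. 4. W.h.p., every connected component of $G'$ has at most $d^{O(\log\log_{1/p} n)}$ nodes, and any two of its nodes are at distance $O(\log_{1/p} n)$ in $G$. 5. W.h.p., $G'$ admits an $(O(\log\log_{1/p} n),O(\log^2\log_{1/p} n))$ network decomposition with respect to distances in $G$: the nodes of $G'$ can be partitioned into clusters, any two nodes of the same cluster being at distance $O((\log\log_{1/p} n)^2)$ in $G$, and the clusters can be coloured with $O(\log\log_{1/p} n)$ colours such that clusters joined by an edge of $G'$ have different colours. -/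

import Mathlib

open MeasureTheory

universe u v w

/-- An instance of the (variable version of the) Lovász Local Lemma: finitely many bad events with
unique identifiers, determined by independent random variables with values in a measurable
space `S`. The variable `x` has distribution `law x`; the event `e` is a measurable set of
assignments that depends only on the variables in `vbl e`. (Variables with different ranges are
covered by taking for `S` the disjoint union of the ranges.) -/
structure LLLInstance (S : Type u) [MeasurableSpace S] where
  Event : Type v
  Var : Type w
  [finite_event : Finite Event]
  ident : Event → ℕ
  ident_injective : Function.Injective ident
  law : Var → Measure S
  [isProb_law : ∀ x, IsProbabilityMeasure (law x)]
  vbl : Event → Set Var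
  bad : Event → Set (Var → S)
  measurableSet_bad : ∀ e, MeasurableSet (bad e)
  dependsOn_bad : ∀ e, DependsOn (fun a : Var → S => a ∈ bad e) (vbl e)

attribute [instance] LLLInstance.finite_event LLLInstance.isProb_law

namespace LLLInstance

variable {S : Type u} [MeasurableSpace S] (I : LLLInstance.{u, v, w} S)

/-- The dependency graph: distinct events are adjacent iff they share a variable. -/
def graph : SimpleGraph I.Event where
  Adj e f := e ≠ f ∧ (I.vbl e ∩ I.vbl f).Nonempty
  symm := ⟨fun _ _ h => ⟨h.1.symm, by rw [Set.inter_comm]; exact h.2⟩⟩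
  loopless := ⟨fun _ h => h.1 rfl⟩

/-- There are `n` bad events, each of probability at most `p` and each dependent on at most `d`
others. -/
structure HasParams (n d : ℕ) (p : ℝ) : Prop where
  card_event : Nat.card I.Event = n
  degree_le : ∀ e, (I.graph.neighborSet e).ncard ≤ d
  prob_le : ∀ e, Measure.infinitePi I.law (I.bad e) ≤ ENNReal.ofReal p

/-- A randomness table: the entry `(x, k)` is the value that `x` takes after having been resampled
`k` times. -/
abbrev Table : Type (max u w) := I.Var × ℕ → S

/-- The distribution of the randomness table: all entries are independent, and the entries of `x`
have the distribution of `x`. -/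
noncomputable def tableLaw : Measure I.Table := Measure.infinitePi (fun q : I.Var × ℕ => I.law q.1)

/-- Probability at least `1 - n ^ (-c)`, where `n` is the number of events (the complement has
outer measure at most `n ^ (-c)`, so nothing is presupposed on measurability). -/
def Whp (c : ℝ) (P : I.Table → Prop) : Prop :=
  I.tableLaw {ω | ¬ P ω} ≤ ENNReal.ofReal ((Nat.card I.Event : ℝ) ^ (-c))

section Algorithm

variable {I}

/-- The current assignment when each variable `x` has been resampled `k x` times. -/
def current (ω : I.Table) (k : I.Var → ℕ) : I.Var → S := fun x => ω (x, k x)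

/-- The satisfied events that have no satisfied neighbour with a lower identifier. -/
def locallyMinimal (a : I.Var → S) : Set I.Event :=
  {e | a ∈ I.bad e ∧ ∀ f, I.graph.Adj e f → a ∈ I.bad f → I.ident e < I.ident f}

open Classical in
/-- The algorithm of Chung, Pettie and Su: `resampleCount ω t x` is the number of times that `x`
has been resampled in the first `t` rounds. In each round, all dependent variables of the satisfied
events with locally minimal identifiers are resampled (these events are pairwise non-adjacent, so
that each variable is resampled at most once in a round). Once no event is satisfied, nothing
changes any more. -/
noncomputable def resampleCount (ω : I.Table) : ℕ → I.Var → ℕ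
  | 0 => fun _ => 0
  | t + 1 => fun x => resampleCount ω t x +
      if ∃ e ∈ locallyMinimal (current ω (resampleCount ω t)), x ∈ I.vbl e then 1 else 0

/-- The dependent variables of `e` are not resampled after the first `T` rounds. -/
def FixedAfter (ω : I.Table) (T : ℕ) (e : I.Event) : Prop :=
  ∀ x ∈ I.vbl e, ∀ t, T ≤ t → resampleCount ω t x = resampleCount ω T x

end Algorithm

/-- The events at distance at most `r` from `e` in the dependency graph. -/
def ball (e : I.Event) (r : ℕ) : Set I.Event := {f | I.graph.edist e f ≤ r}

/-- The variables on which some event at distance at most `r` from `e` depends. -/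
def ballVars (e : I.Event) (r : ℕ) : Set I.Var := {x | ∃ f ∈ I.ball e r, x ∈ I.vbl f}

end LLLInstance

section Local

variable {S : Type u} [MeasurableSpace S]

/-- The radius-`r` neighbourhoods of `e` in `(I, ω)` and of `e'` in `(I', ω')` look the same:
up to renaming events and variables, they have the same events with the same identifiers, the same
variables with the same distributions, the same dependencies (hence the same edges), the same
specifications of the events, and the same entries of the randomness table. -/
def SameNeighborhood (r : ℕ) (I I' : LLLInstance.{u, v, w} S) (ω : I.Table) (ω' : I'.Table)
    (e : I.Event) (e' : I'.Event) : Prop :=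
  ∃ (φ : I.ball e r ≃ I'.ball e' r) (ψ : I.ballVars e r ≃ I'.ballVars e' r),
    (∀ f : I.ball e r, f.1 = e ↔ (φ f).1 = e') ∧
    (∀ f : I.ball e r, I'.ident (φ f).1 = I.ident f.1) ∧
    (∀ x : I.ballVars e r, I'.law (ψ x).1 = I.law x.1) ∧
    (∀ (f : I.ball e r) (x : I.ballVars e r), x.1 ∈ I.vbl f.1 ↔ (ψ x).1 ∈ I'.vbl (φ f).1) ∧
    (∀ (f : I.ball e r) (a : I.Var → S) (a' : I'.Var → S),
      (∀ x : I.ballVars e r, a' (ψ x).1 = a x.1) →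
        (a ∈ I.bad f.1 ↔ a' ∈ I'.bad (φ f).1)) ∧
    (∀ (x : I.ballVars e r) (k : ℕ), ω' ((ψ x).1, k) = ω (x.1, k))

/-- A property of events (under a given randomness table), defined on all instances. -/
abbrev EventProperty (S : Type u) [MeasurableSpace S] : Type (max u (v + 1) (w + 1)) :=
  ∀ I : LLLInstance.{u, v, w} S, I.Table → I.Event → Prop

/-- Whether an event has the property depends only on its radius-`r` neighbourhood. -/
def EventProperty.IsLocal (Q : EventProperty.{u, v, w} S) (r : ℕ) : Prop :=
  ∀ (I I' : LLLInstance.{u, v, w} S) (ω : I.Table) (ω' : I'.Table) (e : I.Event) (e' : I'.Event),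
    SameNeighborhood r I I' ω ω' e e' → (Q I ω e ↔ Q I' ω' e')

end Local

/-- A `(k, D)` network decomposition of the subgraph of `G` induced by `W`, with respect to
distances in `G`: the vertices in `W` are partitioned into clusters of diameter at most `D`
(measured in `G`), and the clusters are coloured with `k` colours such that adjacent clusters have
different colours. -/
def HasNetworkDecomposition {V : Type*} (G : SimpleGraph V) (W : Set V) (k D : ℕ) : Prop :=
  ∃ (cluster : W → W) (color : W → Fin k),
    (∀ x y : W, cluster x = cluster y → G.edist x.1 y.1 ≤ D) ∧
    (∀ x y : W, (G.induce W).Adj x y → cluster x ≠ cluster y →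
      color (cluster x) ≠ color (cluster y))

/-! ### Independence of the entries of the randomness table -/

namespace LLLInstance

open ProbabilityTheory

variable {S : Type u} [MeasurableSpace S] (I : LLLInstance.{u, v, w} S)

/-! Late resamplings have large histories. If `f` is resampled in round `t + 1`, some event within
distance two is resampled in round `t` (`exists_near_resampled`), so the history of a resampling,
i.e. everything reached from it backwards in time by steps between events at distance at most two,
grows at least linearly with the round. Sort the history into layers by the length of the longest
chain. Two different resamplings of a variable lie in different layers, the later one in the earlier
layer. Hence the table entry of `x` that a resampling reads is the number of occurrences of `x` in
deeper layers: the layers, without the rounds, determine the entries (`position_historyLayer`).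
Distinct members read disjoint entries, so a given layered sequence of size `m` is consistent with
the table with probability at most `p ^ m` (`tableLaw_forall_bad_le`), whereas the sequences have
bounded total weight if each member counts `1 / (3 * (d + 1) ^ 2)` (`sum_isLayered_le`). Thus w.h.p.
every history has size at most `M`, of order `log_{1/p} n`.

To make this local, cut the history off at a ball. Members at the boundary cannot be checked against
the table, since resamplings outside the ball may be missing. They cost a factor in the count and
gain no factor `p`, so only a proportion `ε` of them is affordable. An event is insecure if, for one
of `J + 1` nested balls, there is a witness with at least `K` checked members and few unchecked
ones. If a variable of a secure event were resampled after round `K`, its cut-off history would grow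
by a factor `1 + ε` from each ball to the next and would exceed `M` after `J` enlargements
(`NoLargeWitness.fixedAfter`). So `J`, and with it `K`, can be of order `log log_{1/p} n`.

Insecurity is determined by the table within radius `R = 2K + 2J + 2`, so it is independent for
events at distance more than `2R + 1`. Let `Q` be a maximal set of insecure events at such
distances. A union bound on the size of `Q` bounds the number of insecure events. For the
components, join members of `Q` at distance at most `4R + 3`, and apply the weighted count to the
breadth-first layers of a component of this graph. Each further member has about `d ^ (8K)` choices
and is insecure with probability about `(p * d ^ 2) ^ K`, which is where the exponent `10 = 8 + 2`
comes from; the slack `δ` absorbs `ε`, `J` and the constants. Ball growing in this graph on `Q`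
yields the network decomposition, and distances in `G` are larger by a factor of at most `4R + 3`.
-/

instance isProbabilityMeasure_tableLaw : IsProbabilityMeasure I.tableLaw := by
  unfold tableLaw; infer_instance

/-- The σ-algebra generated by a set of entries of the randomness table. -/
abbrev entrySigma (A : Set (I.Var × ℕ)) : MeasurableSpace I.Table :=
  ⨆ q ∈ A, MeasurableSpace.comap (fun ω : I.Table => ω q) inferInstance

lemma entrySigma_mono {A B : Set (I.Var × ℕ)} (h : A ⊆ B) : I.entrySigma A ≤ I.entrySigma B :=
  biSup_mono fun _ hq => h hq

lemma measurable_entry {A : Set (I.Var × ℕ)} {q : I.Var × ℕ} (hq : q ∈ A) :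
    Measurable[I.entrySigma A] (fun ω : I.Table => ω q) :=
  measurable_iff_comap_le.2 <|
    le_biSup (fun q => MeasurableSpace.comap (fun ω : I.Table => ω q) inferInstance) hq

lemma indep_entrySigma {A B : Set (I.Var × ℕ)} (h : Disjoint A B) :
    Indep (I.entrySigma A) (I.entrySigma B) I.tableLaw := by
  refine indep_iSup_of_disjoint (fun q => (measurable_pi_apply q).comap_le) ?_ h
  exact iIndepFun_infinitePi (P := fun q : I.Var × ℕ => I.law q.1) (X := fun _ s => s)
    (fun _ => measurable_id)

lemma measurableSet_biInter_entrySigma {ι : Type*} (s : Finset ι) {A : ι → Set (I.Var × ℕ)}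
    {E : ι → Set I.Table} (hE : ∀ i ∈ s, MeasurableSet[I.entrySigma (A i)] (E i)) :
    MeasurableSet[I.entrySigma (⋃ i ∈ s, A i)] (⋂ i ∈ s, E i) :=
  @Finset.measurableSet_biInter _ _ (I.entrySigma (⋃ i ∈ s, A i)) _ s fun i hi =>
    I.entrySigma_mono (Set.subset_biUnion_of_mem (u := A) (Finset.mem_coe.2 hi)) _ (hE i hi)

/-- Sets of tables that depend on disjoint sets of entries are independent. -/
lemma tableLaw_biInter_eq_prod {ι : Type*} (s : Finset ι) {A : ι → Set (I.Var × ℕ)}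
    {E : ι → Set I.Table} (hE : ∀ i ∈ s, MeasurableSet[I.entrySigma (A i)] (E i))
    (hA : ∀ i ∈ s, ∀ j ∈ s, i ≠ j → Disjoint (A i) (A j)) :
    I.tableLaw (⋂ i ∈ s, E i) = ∏ i ∈ s, I.tableLaw (E i) := by
  classical
  induction s using Finset.induction_on with
  | empty => simp
  | insert a s ha ih =>
    rw [Finset.set_biInter_insert, Finset.prod_insert ha,
      ← ih (fun i hi => hE i (Finset.mem_insert_of_mem hi)) (fun i hi j hj =>
        hA i (Finset.mem_insert_of_mem hi) j (Finset.mem_insert_of_mem hj))]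
    have hd : Disjoint (A a) (⋃ i ∈ s, A i) := by
      simp only [Set.disjoint_iUnion_right]
      exact fun i hi => hA a (Finset.mem_insert_self a s) i (Finset.mem_insert_of_mem hi)
        fun h => ha (h ▸ hi)
    exact (Indep_iff _ _ _).1 (I.indep_entrySigma hd) _ _ (hE a (Finset.mem_insert_self a s))
      (I.measurableSet_biInter_entrySigma s fun i hi => hE i (Finset.mem_insert_of_mem hi))

variable {I}

lemma measurableSet_current_mem_bad (e : I.Event) (k : I.Var → ℕ) :
    MeasurableSet[I.entrySigma {q | q.1 ∈ I.vbl e ∧ q.2 = k q.1}]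
      {ω | current ω k ∈ I.bad e} := by
  classical
  rcases (I.bad e).eq_empty_or_nonempty with h | ⟨a, -⟩
  · simp only [h, Set.mem_empty_iff_false, Set.ofPred_false]
    exact @MeasurableSet.empty _ (I.entrySigma _)
  -- Filling in a fixed assignment `a` outside `vbl e` gives a map that reads only the listed
  -- entries and does not affect membership in `bad e`.
  · have hg : Measurable[I.entrySigma {q | q.1 ∈ I.vbl e ∧ q.2 = k q.1}]
        (fun (ω : I.Table) (x : I.Var) => if x ∈ I.vbl e then ω (x, k x) else a x) := by
      refine @measurable_pi_lambda _ _ _ (I.entrySigma _) _ _ fun x => ?_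
      by_cases hx : x ∈ I.vbl e
      · simp only [hx, if_true]
        exact I.measurable_entry ⟨hx, rfl⟩
      · simp only [hx, if_false]
        exact @measurable_const _ _ _ (I.entrySigma _) _
    convert hg (I.measurableSet_bad e) using 1
    ext ω
    have := I.dependsOn_bad e (x := current ω k)
      (y := fun x => if x ∈ I.vbl e then ω (x, k x) else a x)
      (fun x hx => by simp [current, hx])
    simpa using this

/-- Since `x ↦ (x, k x)` is injective, reading one entry for each variable pushes the table law
forward to the product law. -/
lemma tableLaw_current_mem_bad (e : I.Event) (k : I.Var → ℕ) :
    I.tableLaw {ω | current ω k ∈ I.bad e} = Measure.infinitePi I.law (I.bad e) := by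
  have h := Measure.map_infinitePi_infinitePi_of_inj (P := fun q : I.Var × ℕ => I.law q.1)
    (f := fun x => (x, k x)) (fun x y h => (Prod.ext_iff.1 h).1)
  rw [← h, Measure.map_apply (by fun_prop) (I.measurableSet_bad e)]
  rfl

end LLLInstance

/-! ### Weighted counting of layered sequences -/

section Layers

variable {α : Type*}

/-- A sequence of `h` layers such that each element has an `N`-predecessor in the preceding layer,
where `Q` precedes the first layer. -/
def IsLayered (N : α → α → Prop) : (h : ℕ) → Finset α → (Fin h → Finset α) → Prop
  | 0, _, _ => True
  | h + 1, Q, F => (∀ b ∈ F 0, ∃ a ∈ Q, N a b) ∧ IsLayered N h (F 0) (Fin.tail F)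

lemma isLayered_of_forall {N : α → α → Prop} (G : ℕ → Finset α)
    (hG : ∀ j, ∀ b ∈ G (j + 1), ∃ a ∈ G j, N a b) (h : ℕ) :
    ∀ i : ℕ, IsLayered N h (G i) (fun j => G (i + 1 + j)) := by
  induction h with
  | zero => exact fun _ => trivial
  | succ h ih =>
    intro i
    refine ⟨fun b hb => hG i b (by simpa using hb), ?_⟩
    have : Fin.tail (fun j : Fin (h + 1) => G (i + 1 + j)) =
          fun j : Fin h => G (i + 1 + 1 + j) := by
      funext j
      simp only [Fin.tail, Fin.val_succ]
      congr 1
      omega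
    rw [this]
    exact ih (i + 1)

/-- Layered sequences are preserved by maps that preserve the relation. -/
lemma IsLayered.image {β : Type*} [DecidableEq β] {N : α → α → Prop} {N' : β → β → Prop}
    (φ : α → β) (A : Set α) (hN : ∀ a ∈ A, ∀ b ∈ A, N a b → N' (φ a) (φ b)) {h : ℕ} :
    ∀ {Q : Finset α} {F : Fin h → Finset α}, (∀ a ∈ Q, a ∈ A) → (∀ j, ∀ a ∈ F j, a ∈ A) →
      IsLayered N h Q F → IsLayered N' h (Q.image φ) (fun j => (F j).image φ) := by
  induction h with
  | zero => exact fun _ _ _ => trivial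
  | succ h ih =>
    intro Q F hQ hA hF
    refine ⟨?_, ih (hA 0) (fun j => hA j.succ) hF.2⟩
    intro b' hb'
    obtain ⟨b, hb, rfl⟩ := Finset.mem_image.1 hb'
    obtain ⟨a, ha, hab⟩ := hF.1 b hb
    exact ⟨φ a, Finset.mem_image_of_mem _ ha, hN a (hQ a ha) b (hA 0 b hb) hab⟩

open Classical in
/-- The layered sequences that start from `Q` have total weight at most `3 ^ #Q`, when each element
has weight `1 / (3 * D)` and at most `D` successors. -/
theorem sum_isLayered_le [Fintype α] {N : α → α → Prop} {D : ℕ} (hD : 1 ≤ D)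
    (hN : ∀ a, (Finset.univ.filter fun b => N a b).card ≤ D) (h : ℕ) (Q : Finset α) :
    ∑ F : Fin h → Finset α with IsLayered N h Q F,
      (1 / (3 * D) : ℝ) ^ (∑ j, (F j).card) ≤ 3 ^ Q.card := by
  have hD' : (1 : ℝ) ≤ D := by exact_mod_cast hD
  set E : ℝ := (1 + 1 / D) ^ D with hE
  have hE1 : 1 ≤ E := one_le_pow₀ (by simp)
  have hE3 : E ≤ 3 := by
    have h1 : (1 + 1 / D : ℝ) ≤ Real.exp (1 / D) := by
      have := Real.add_one_le_exp (1 / D : ℝ); linarith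
    calc E ≤ Real.exp (1 / D) ^ D := pow_le_pow_left₀ (by positivity) h1 D
      _ = Real.exp 1 := by
        rw [← Real.exp_nat_mul]; congr 1; field_simp
      _ ≤ 3 := by have := Real.exp_one_lt_d9; linarith
  set z : ℝ := 1 / (3 * D) with hz
  have hz0 : 0 ≤ z := by positivity
  have hzE : z * E ≤ 1 / D := by
    calc z * E ≤ z * 3 := by gcongr
      _ = 1 / D := by rw [hz]; field_simp
  -- The bound with `E = (1 + 1 / D) ^ D` reproduces itself under the induction: the possible first
  -- layers are subsets of at most `D * #Q` successors, and `z * E ≤ 1 / D` gives `(1 + z * E) ^ (D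
  -- * #Q) ≤ E ^ #Q`.
  suffices H : ∀ Q : Finset α, ∑ F : Fin h → Finset α with IsLayered N h Q F,
      z ^ (∑ j, (F j).card) ≤ E ^ Q.card from
    (H Q).trans (pow_le_pow_left₀ (by positivity) hE3 _)
  induction h with
  | zero => intro Q; simpa [IsLayered] using one_le_pow₀ hE1
  | succ h ih =>
    intro Q
    set NQ : Finset α := Finset.univ.filter fun b => ∃ a ∈ Q, N a b with hNQ
    have hcard : NQ.card ≤ D * Q.card := by
      have : NQ = Q.biUnion fun a => Finset.univ.filter fun b => N a b := by
        ext b; simp [hNQ]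
      rw [this, mul_comm]
      exact Finset.card_biUnion_le_card_mul _ _ _ fun a _ => hN a
    have hsum : ∑ F : Fin (h + 1) → Finset α with IsLayered N (h + 1) Q F,
        z ^ (∑ j, (F j).card) =
        ∑ L ∈ NQ.powerset, z ^ L.card *
          ∑ F : Fin h → Finset α with IsLayered N h L F, z ^ (∑ j, (F j).card) := by
      rw [Finset.sum_filter, ← (Fin.consEquiv fun _ : Fin (h + 1) => Finset α).sum_comp,
        Fintype.sum_prod_type, ← Finset.sum_subset (Finset.subset_univ NQ.powerset)]
      · refine Finset.sum_congr rfl fun L hL => ?_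
        rw [Finset.mul_sum, Finset.sum_filter]
        refine Finset.sum_congr rfl fun F _ => ?_
        have : IsLayered N (h + 1) Q (Fin.cons L F : Fin (h + 1) → Finset α) ↔
            IsLayered N h L F := by
          simp only [IsLayered, Fin.cons_zero, Fin.tail_cons, and_iff_right_iff_imp]
          intro _ b hb
          simpa [hNQ] using Finset.mem_powerset.1 hL hb
        simp only [Fin.consEquiv, Equiv.coe_fn_mk, this, Fin.sum_univ_succ, Fin.cons_zero,
          Fin.cons_succ, pow_add]
      · refine fun L _ hL => Finset.sum_eq_zero fun F _ => if_neg fun hF => hL ?_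
        refine Finset.mem_powerset.2 fun b hb => ?_
        simpa [hNQ] using hF.1 b (by simpa [Fin.consEquiv] using hb)
    rw [hsum]
    calc ∑ L ∈ NQ.powerset, z ^ L.card *
          ∑ F : Fin h → Finset α with IsLayered N h L F, z ^ (∑ j, (F j).card)
        ≤ ∑ L ∈ NQ.powerset, z ^ L.card * E ^ L.card := by
          gcongr with L _; exact ih L
      _ = (z * E + 1) ^ NQ.card := by
          rw [← Finset.sum_pow_mul_eq_add_pow]
          simp [mul_pow]
      _ ≤ (1 + 1 / D) ^ NQ.card := by
          apply pow_le_pow_left₀ (by positivity); linarith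
      _ ≤ (1 + 1 / D) ^ (D * Q.card) := pow_le_pow_right₀ (by simp) hcard
      _ = E ^ Q.card := by rw [pow_mul]

end Layers

/-! ### Balls and network decompositions by ball growing -/

namespace SimpleGraph

variable {V : Type*} (G : SimpleGraph V)

lemma edist_le_add_one_iff {u w : V} {r : ℕ} :
    G.edist u w ≤ (r + 1 : ℕ) ↔ ∃ v, G.edist u v ≤ r ∧ (v = w ∨ G.Adj v w) := by
  constructor
  · intro h
    have hne : G.edist u w ≠ ⊤ := ne_top_of_le_ne_top (ENat.natCast_ne_top _) h
    obtain ⟨p, hp⟩ := exists_walk_of_edist_ne_top hne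
    rw [← hp, Nat.cast_le, ← Walk.length_reverse] at h
    cases hq : p.reverse with
    | nil => exact ⟨u, by simp, Or.inl rfl⟩
    | cons hvw q =>
      rw [hq, Walk.length_cons] at h
      refine ⟨_, (edist_le q.reverse).trans ?_, Or.inr hvw.symm⟩
      rw [Walk.length_reverse]
      exact_mod_cast (by omega : q.length ≤ r)
  · rintro ⟨v, hv, rfl | hvw⟩
    · exact hv.trans (by exact_mod_cast Nat.le_succ r)
    · calc G.edist u w ≤ G.edist u v + G.edist v w := G.edist_triangle
        _ ≤ r + 1 := add_le_add hv (edist_eq_one_iff_adj.2 hvw).le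
        _ = (r + 1 : ℕ) := by push_cast; rfl

lemma ncard_edist_le [Finite V] {d : ℕ} (hd : ∀ v, (G.neighborSet v).ncard ≤ d) (u : V) (r : ℕ) :
    {v | G.edist u v ≤ r}.ncard ≤ (d + 1) ^ r := by
  classical
  induction r with
  | zero => simp
  | succ r ih =>
    have h : {v | G.edist u v ≤ (r + 1 : ℕ)} ⊆
        ⋃ v ∈ {v | G.edist u v ≤ r}, insert v (G.neighborSet v) := by
      intro w hw
      obtain ⟨v, hv, h⟩ := G.edist_le_add_one_iff.1 hw
      simp only [Set.mem_iUnion]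
      exact ⟨v, hv, h.imp Eq.symm id⟩
    have := Fintype.ofFinite V
    calc _ ≤ (⋃ v ∈ {v | G.edist u v ≤ r}, insert v (G.neighborSet v)).ncard :=
          Set.ncard_le_ncard h (Set.toFinite _)
      _ ≤ ({v | G.edist u v ≤ r}.ncard) * (d + 1) := by
          rw [Set.ncard_eq_toFinset_card' {v | G.edist u v ≤ r}, Set.ncard_eq_toFinset_card']
          have : (⋃ v ∈ {v | G.edist u v ≤ r}, insert v (G.neighborSet v)).toFinset =
              ({v | G.edist u v ≤ r}.toFinset).biUnion
                fun v => (insert v (G.neighborSet v)).toFinset := by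
            ext w; simp
          rw [this]
          refine Finset.card_biUnion_le_card_mul _ _ _ fun v _ => ?_
          rw [← Set.ncard_eq_toFinset_card']
          exact (Set.ncard_insert_le _ _).trans (Nat.succ_le_succ (hd v))
      _ ≤ (d + 1) ^ (r + 1) := by rw [pow_succ]; gcongr

open Classical in
/-- One phase of ball growing: at least half of the vertices can be covered by pairwise
non-adjacent clusters of small diameter. -/
lemma exists_separated_clusters (k : ℕ) (X : Finset V) (hX : X.card < 2 ^ k) :
    ∃ A ⊆ X, ∃ cl : V → V, (X \ A).card ≤ A.card ∧ (∀ v ∈ A, cl v ∈ A) ∧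
      (∀ u ∈ A, ∀ v ∈ A, cl u = cl v → G.edist u v ≤ (2 * k : ℕ)) ∧
      (∀ u ∈ A, ∀ v ∈ A, G.Adj u v → cl u = cl v) := by
  induction X using Finset.strongInduction with
  | H X ih =>
  rcases X.eq_empty_or_nonempty with rfl | ⟨v, hv⟩
  · exact ⟨∅, subset_rfl, id, by simp⟩
  -- Balls around `v` in the graph induced by `X`. One that at most doubles in the next step becomes
  -- a cluster; its outer shell, which is no larger, is left for later phases, and the construction
  -- recurses outside both.
  obtain ⟨B, hB0, hBs⟩ : ∃ B : ℕ → Finset V, B 0 = {v} ∧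
      ∀ i, B (i + 1) = X.filter fun x => x ∈ B i ∨ ∃ u ∈ B i, G.Adj u x :=
    ⟨fun i => Nat.rec {v} (fun _ (B : Finset V) =>
      X.filter fun x : V => x ∈ B ∨ ∃ u ∈ B, G.Adj u x) i, rfl, fun _ => rfl⟩
  have hBX : ∀ i, B i ⊆ X := by
    intro i
    cases i with
    | zero => simpa [hB0] using hv
    | succ i => rw [hBs]; exact Finset.filter_subset _ _
  have hmono : ∀ i, B i ⊆ B (i + 1) := fun i x hx => by
    rw [hBs, Finset.mem_filter]; exact ⟨hBX i hx, Or.inl hx⟩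
  have hvB : ∀ i, v ∈ B i := by
    intro i
    induction i with
    | zero => simp [hB0]
    | succ i hi => exact hmono i hi
  have hdist : ∀ i, ∀ x ∈ B i, G.edist v x ≤ (i : ℕ) := by
    intro i
    induction i with
    | zero => intro x hx; rw [hB0, Finset.mem_singleton] at hx; simp [hx]
    | succ i hi =>
      intro x hx
      rw [hBs, Finset.mem_filter] at hx
      refine G.edist_le_add_one_iff.2 ?_
      rcases hx.2 with h | ⟨u, hu, hux⟩
      · exact ⟨x, hi x h, Or.inl rfl⟩
      · exact ⟨u, hi u hu, Or.inr hux⟩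
  -- Doubling at each of the first `k` steps would give `2 ^ k` vertices, more than `X` has.
  obtain ⟨i, hik, hi⟩ : ∃ i < k, (B (i + 1)).card ≤ 2 * (B i).card := by
    by_contra! hcon
    have : ∀ i ≤ k, 2 ^ i ≤ (B i).card := by
      intro i
      induction i with
      | zero => intro _; simp [hB0]
      | succ i hi =>
        intro hik
        have := hcon i hik
        have := hi (by omega)
        rw [pow_succ]; omega
    exact absurd ((this k le_rfl).trans (Finset.card_le_card (hBX k))) (by omega)
  obtain ⟨A, hAX, cl, hcard, hcl, hdiam, hadj⟩ := ih (X \ B (i + 1))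
    (Finset.sdiff_ssubset (hBX _) ⟨v, hvB _⟩)
    ((Finset.card_le_card Finset.sdiff_subset).trans_lt hX)
  have hAB : ∀ a ∈ A, a ∉ B (i + 1) := fun a ha => (Finset.mem_sdiff.1 (hAX ha)).2
  have hdisj : Disjoint (B i) A :=
    Finset.disjoint_left.2 fun x hx hxA => hAB x hxA (hmono i hx)
  have hnot : ∀ x ∈ B i, ∀ a ∈ A, ¬ G.Adj x a := fun x hx a ha hxa =>
    hAB a ha (by rw [hBs, Finset.mem_filter]
                 exact ⟨Finset.sdiff_subset (hAX ha), Or.inr ⟨x, hx, hxa⟩⟩)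
  refine ⟨B i ∪ A, Finset.union_subset (hBX i) (hAX.trans Finset.sdiff_subset),
    fun x => if x ∈ B i then v else cl x, ?_, ?_, ?_, ?_⟩
  · have hsub : X \ (B i ∪ A) ⊆ (B (i + 1) \ B i) ∪ ((X \ B (i + 1)) \ A) := by
      intro x hx
      simp only [Finset.mem_sdiff, Finset.mem_union] at hx ⊢
      tauto
    calc _ ≤ _ := Finset.card_le_card hsub
      _ ≤ (B (i + 1) \ B i).card + ((X \ B (i + 1)) \ A).card := Finset.card_union_le _ _
      _ ≤ (B i).card + A.card := by
        rw [Finset.card_sdiff_of_subset (hmono i)]; omega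
      _ = _ := (Finset.card_union_of_disjoint hdisj).symm
  · intro x hx
    by_cases h : x ∈ B i
    · simp only [h, if_true]; exact Finset.mem_union_left _ (hvB i)
    · simp only [h, if_false]
      exact Finset.mem_union_right _ (hcl x ((Finset.mem_union.1 hx).resolve_left h))
  · have hne : ∀ a ∈ A, cl a ≠ v := fun a ha h =>
      Finset.disjoint_left.1 hdisj (hvB i) (h ▸ hcl a ha)
    intro x hx y hy hxy
    by_cases h : x ∈ B i <;> by_cases h' : y ∈ B i <;> simp only [h, h', if_true, if_false] at hxy
    · calc G.edist x y ≤ G.edist x v + G.edist v y := G.edist_triangle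
        _ ≤ (i : ℕ) + (i : ℕ) := add_le_add (by rw [edist_comm]; exact hdist i x h) (hdist i y h')
        _ ≤ (2 * k : ℕ) := by exact_mod_cast (by omega : i + i ≤ 2 * k)
    · exact absurd hxy.symm (hne y ((Finset.mem_union.1 hy).resolve_left h'))
    · exact absurd hxy (hne x ((Finset.mem_union.1 hx).resolve_left h))
    · exact hdiam x ((Finset.mem_union.1 hx).resolve_left h) y
        ((Finset.mem_union.1 hy).resolve_left h') hxy
  · intro x hx y hy hxy
    by_cases h : x ∈ B i <;> by_cases h' : y ∈ B i <;> simp only [h, h', if_true, if_false]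
    · exact absurd hxy (hnot x h y ((Finset.mem_union.1 hy).resolve_left h'))
    · exact absurd hxy.symm (hnot y h' x ((Finset.mem_union.1 hx).resolve_left h))
    · exact hadj x ((Finset.mem_union.1 hx).resolve_left h) y
        ((Finset.mem_union.1 hy).resolve_left h') hxy

open Classical in
/-- Fewer than `2 ^ k` vertices have a network decomposition with `k` colours into clusters of
diameter at most `2 * k`. -/
lemma exists_decomposition_finset (k : ℕ) : ∀ j ≤ k, ∀ X : Finset V, X.card < 2 ^ j →
    ∃ (cl : V → V) (col : V → ℕ), (∀ v ∈ X, cl v ∈ X) ∧ (∀ v ∈ X, col v < j) ∧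
      (∀ v ∈ X, col (cl v) = col v) ∧
      (∀ u ∈ X, ∀ v ∈ X, cl u = cl v → G.edist u v ≤ (2 * k : ℕ)) ∧
      (∀ u ∈ X, ∀ v ∈ X, G.Adj u v → cl u ≠ cl v → col u ≠ col v) := by
  intro j
  induction j with
  | zero =>
    intro _ X hX
    have : X = ∅ := by simpa using hX
    subst this
    exact ⟨id, fun _ => 0, by simp⟩
  | succ j ih =>
    intro hjk X hX
    obtain ⟨A, hAX, cl, hcard, hcl, hdiam, hadj⟩ := G.exists_separated_clusters (j + 1) X hX
    -- Each phase covers at least half of the remaining vertices and uses up one colour, here `j`.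
    have hXA : (X \ A).card < 2 ^ j := by
      have := Finset.card_sdiff_add_card_eq_card hAX
      rw [pow_succ] at hX; omega
    obtain ⟨cl', col', hcl', hcol', hcc', hdiam', hadj'⟩ := ih (by omega) (X \ A) hXA
    have hr : ∀ {v}, v ∈ X → v ∉ A → v ∈ X \ A := fun h h' => Finset.mem_sdiff.2 ⟨h, h'⟩
    have hn : ∀ {v}, v ∈ X → v ∉ A → cl' v ∉ A := fun h h' =>
      (Finset.mem_sdiff.1 (hcl' _ (hr h h'))).2
    refine ⟨fun v => if v ∈ A then cl v else cl' v, fun v => if v ∈ A then j else col' v,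
      ?_, ?_, ?_, ?_, ?_⟩
    · intro v hv
      by_cases h : v ∈ A <;> simp only [h, if_true, if_false]
      · exact hAX (hcl v h)
      · exact Finset.sdiff_subset (hcl' v (hr hv h))
    · intro v hv
      by_cases h : v ∈ A <;> simp only [h, if_true, if_false]
      · exact Nat.lt_succ_self j
      · exact (hcol' v (hr hv h)).trans (Nat.lt_succ_self j)
    · intro v hv
      by_cases h : v ∈ A <;> simp only [h, if_true, if_false]
      · simp [hcl v h]
      · simp [hn hv h, hcc' v (hr hv h)]
    · intro u hu v hv huv
      by_cases h : u ∈ A <;> by_cases h' : v ∈ A <;>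
        simp only [h, h', if_true, if_false] at huv
      · exact (hdiam u h v h' huv).trans (by exact_mod_cast (by omega : 2 * (j + 1) ≤ 2 * k))
      · exact absurd (huv ▸ hcl u h) (hn hv h')
      · exact absurd (huv ▸ hcl v h') (hn hu h)
      · exact hdiam' u (hr hu h) v (hr hv h') huv
    · intro u hu v hv huv hne
      by_cases h : u ∈ A <;> by_cases h' : v ∈ A <;>
        simp only [h, h', if_true, if_false] at hne ⊢
      · exact absurd (hadj u h v h' huv) hne
      · exact (hcol' v (hr hv h')).ne'
      · exact (hcol' u (hr hu h)).ne
      · exact hadj' u (hr hu h) v (hr hv h') huv hne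

/-- A graph whose components have fewer than `2 ^ k` vertices has a network decomposition with `k`
colours into clusters of diameter at most `2 * k`. -/
lemma exists_decomposition [Finite V] (k : ℕ)
    (h : ∀ K : G.ConnectedComponent, K.supp.ncard < 2 ^ k) :
    ∃ (cl : V → V) (col : V → ℕ), (∀ v, col v < k) ∧ (∀ v, col (cl v) = col v) ∧
      (∀ u v, cl u = cl v → G.edist u v ≤ (2 * k : ℕ)) ∧
      (∀ u v, G.Adj u v → cl u ≠ cl v → col u ≠ col v) := by
  classical
  have := Fintype.ofFinite V
  have H := fun K : G.ConnectedComponent => G.exists_decomposition_finset k k le_rfl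
    K.supp.toFinset (by rw [← Set.ncard_eq_toFinset_card']; exact h K)
  choose cl col hcl hcol hcc hdiam hadj using H
  have hm : ∀ v, v ∈ (G.connectedComponentMk v).supp.toFinset := by simp
  have hK : ∀ v, G.connectedComponentMk (cl (G.connectedComponentMk v) v) =
      G.connectedComponentMk v := by
    intro v
    have := hcl _ v (hm v)
    simpa using this
  refine ⟨fun v => cl (G.connectedComponentMk v) v, fun v => col (G.connectedComponentMk v) v,
    fun v => hcol _ v (hm v), ?_, ?_, ?_⟩
  · intro v
    simp only [hK v]
    exact hcc _ v (hm v)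
  · intro u v huv
    have : G.connectedComponentMk u = G.connectedComponentMk v := by
      rw [← hK u, ← hK v]; exact congrArg _ huv
    refine hdiam (G.connectedComponentMk u) u (hm u) v (this ▸ hm v) ?_
    simpa only [← this] using huv
  · intro u v huv hne
    have : G.connectedComponentMk u = G.connectedComponentMk v :=
      ConnectedComponent.sound huv.reachable
    simp only [← this] at hne ⊢
    exact hadj _ u (hm u) v (this ▸ hm v) huv hne

end SimpleGraph

/-! ### Rounds of the algorithm and the history of a resampling -/

namespace LLLInstance

variable {S : Type u} [MeasurableSpace S] {I : LLLInstance.{u, v, w} S}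

noncomputable instance fintypeEvent : Fintype I.Event := Fintype.ofFinite _

/-- Two events at distance at most two. -/
def Near (e f : I.Event) : Prop :=
  ∃ h, (h = e ∨ I.graph.Adj e h) ∧ (h = f ∨ I.graph.Adj h f)

lemma near_refl (e : I.Event) : Near e e := ⟨e, Or.inl rfl, Or.inl rfl⟩

lemma eq_or_adj_of_mem_vbl {e f : I.Event} {x : I.Var} (he : x ∈ I.vbl e) (hf : x ∈ I.vbl f) :
    e = f ∨ I.graph.Adj e f := by
  by_cases h : e = f
  · exact Or.inl h
  · exact Or.inr ⟨h, x, he, hf⟩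

lemma near_of_mem_vbl {e f : I.Event} {x : I.Var} (he : x ∈ I.vbl e) (hf : x ∈ I.vbl f) :
    Near e f := ⟨e, Or.inl rfl, eq_or_adj_of_mem_vbl he hf⟩

lemma mem_ball_self (e : I.Event) (r : ℕ) : e ∈ I.ball e r := by simp [ball]

lemma mem_ball_succ_iff {e f : I.Event} {r : ℕ} :
    f ∈ I.ball e (r + 1) ↔ ∃ g ∈ I.ball e r, g = f ∨ I.graph.Adj g f :=
  I.graph.edist_le_add_one_iff

lemma ball_subset_ball {e : I.Event} {r s : ℕ} (h : r ≤ s) : I.ball e r ⊆ I.ball e s :=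
  fun _ hf => le_trans (α := ℕ∞) hf (by exact_mod_cast h)

lemma Near.mem_ball {e f g : I.Event} {r : ℕ} (h : Near f g) (hf : f ∈ I.ball e r) :
    g ∈ I.ball e (r + 2) := by
  obtain ⟨k, hk, hg⟩ := h
  exact mem_ball_succ_iff.2 ⟨k, mem_ball_succ_iff.2 ⟨f, hf, hk.imp Eq.symm id⟩, hg⟩

/-- The events that are resampled in round `t`. -/
def resampled (ω : I.Table) (t : ℕ) : Set I.Event :=
  locallyMinimal (current ω (resampleCount ω t))

lemma eq_of_mem_resampled {ω : I.Table} {t : ℕ} {f g : I.Event} (hf : f ∈ resampled ω t)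
    (hg : g ∈ resampled ω t) {x : I.Var} (hxf : x ∈ I.vbl f) (hxg : x ∈ I.vbl g) : f = g := by
  by_contra h
  have hfg : I.graph.Adj f g := ⟨h, x, hxf, hxg⟩
  exact lt_asymm (hf.2 g hfg hg.1) (hg.2 f hfg.symm hf.1)

open Classical in
lemma resampleCount_succ (ω : I.Table) (t : ℕ) (x : I.Var) :
    resampleCount ω (t + 1) x = resampleCount ω t x +
      if ∃ e ∈ resampled ω t, x ∈ I.vbl e then 1 else 0 := by
  simp only [resampleCount, resampled]
  congr

-- Events resampled in the same round share no variables, so each round contributes at most one pair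
-- to the count.
open Classical in
lemma resampleCount_eq_card (ω : I.Table) (t : ℕ) (x : I.Var) :
    resampleCount ω t x = ((Finset.univ ×ˢ Finset.range t).filter
      fun v : I.Event × ℕ => v.1 ∈ resampled ω v.2 ∧ x ∈ I.vbl v.1).card := by
  induction t with
  | zero => simp [resampleCount]
  | succ t ih =>
    rw [resampleCount_succ, ih, Finset.range_add_one, Finset.insert_eq, Finset.product_union, Finset.filter_union,
      Finset.card_union_of_disjoint, add_comm]
    · congr 1
      split_ifs with h
      · obtain ⟨e, he, hx⟩ := h
        symm
        rw [Finset.card_eq_one]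
        refine ⟨(e, t), ?_⟩
        ext ⟨g, s⟩
        simp only [Finset.mem_filter, Finset.mem_product, Finset.mem_univ, Finset.mem_singleton,
          true_and, Prod.mk.injEq]
        constructor
        · rintro ⟨rfl, hg, hxg⟩
          exact ⟨eq_of_mem_resampled hg he hxg hx, rfl⟩
        · rintro ⟨rfl, rfl⟩
          exact ⟨rfl, he, hx⟩
      · symm
        rw [Finset.card_eq_zero, Finset.filter_eq_empty_iff]
        rintro ⟨g, s⟩ hv ⟨hg, hxg⟩
        simp only [Finset.mem_product, Finset.mem_univ, Finset.mem_singleton, true_and] at hv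
        subst hv
        exact h ⟨g, hg, hxg⟩
    · rw [Finset.disjoint_left]
      rintro ⟨g, s⟩ h h'
      simp only [Finset.mem_filter, Finset.mem_product, Finset.mem_univ, Finset.mem_singleton,
        true_and, Finset.mem_range] at h h'
      omega

/-- If `f` stops being satisfied in round `t`, then one of its variables is resampled. -/
lemma exists_resampled_of_bad_change {ω : I.Table} {t : ℕ} {f : I.Event}
    (h : ¬ (current ω (resampleCount ω t) ∈ I.bad f ↔
      current ω (resampleCount ω (t + 1)) ∈ I.bad f)) :
    ∃ g ∈ resampled ω t, f = g ∨ I.graph.Adj f g := by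
  by_contra! hcon
  refine h (iff_of_eq (I.dependsOn_bad f fun x hx => ?_))
  have : ¬ ∃ e ∈ resampled ω t, x ∈ I.vbl e := by
    rintro ⟨g, hg, hxg⟩
    have := hcon g hg
    exact (eq_or_adj_of_mem_vbl hx hxg).elim this.1 this.2
  simp [current, resampleCount_succ, this]

/-- If `f` is resampled in some round, then an event at distance at most two has been resampled in
the preceding round. -/
lemma exists_near_resampled {ω : I.Table} {t : ℕ} {f : I.Event} (hf : f ∈ resampled ω (t + 1)) :
    ∃ g ∈ resampled ω t, Near f g := by
  by_cases hb : current ω (resampleCount ω t) ∈ I.bad f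
  · by_cases hm : f ∈ resampled ω t
    · exact ⟨f, hm, near_refl f⟩
    · have : ∃ h, I.graph.Adj f h ∧ current ω (resampleCount ω t) ∈ I.bad h ∧
          ¬ I.ident f < I.ident h := by
        by_contra! hcon
        exact hm ⟨hb, hcon⟩
      obtain ⟨h, hfh, hbh, hid⟩ := this
      -- The neighbour `h` that blocked `f` in round `t` cannot hold any longer, for it would block
      -- `f` again. So a variable of `h` was resampled, which accounts for the distance two.
      have hh : ¬ current ω (resampleCount ω (t + 1)) ∈ I.bad h := fun hbh' =>
        hid (hf.2 h hfh hbh')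
      obtain ⟨g, hg, hhg⟩ := exists_resampled_of_bad_change (fun hiff => hh (hiff.1 hbh))
      exact ⟨g, hg, h, Or.inr hfh, hhg⟩
  · obtain ⟨g, hg, hfg⟩ := exists_resampled_of_bad_change (fun hiff => hb (hiff.2 hf.1))
    exact ⟨g, hg, f, Or.inl rfl, hfg⟩

/-- `HistoryChain ω Y u j v`: going back in time from the resampling `u = (f, t)` of the event `f`
in round `t`, the resampling `v` is reached by `j` steps between events at distance at most two,
all in `Y`. -/
inductive HistoryChain (ω : I.Table) (Y : Set I.Event) (u : I.Event × ℕ) :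
    ℕ → I.Event × ℕ → Prop
  | root : HistoryChain ω Y u 0 u
  | step {j : ℕ} {v w : I.Event × ℕ} : HistoryChain ω Y u j v → w.2 < v.2 →
      w.1 ∈ resampled ω w.2 → w.1 ∈ Y → Near v.1 w.1 → HistoryChain ω Y u (j + 1) w

namespace HistoryChain

variable {ω : I.Table} {Y Y' : Set I.Event} {u v w : I.Event × ℕ} {j : ℕ}

lemma time_le (h : HistoryChain ω Y u j v) : v.2 + j ≤ u.2 := by
  induction h with
  | root => simp
  | step _ _ _ _ _ ih => omega

lemma mem_resampled (hu : u.1 ∈ resampled ω u.2) (h : HistoryChain ω Y u j v) :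
    v.1 ∈ resampled ω v.2 := by
  cases h with
  | root => exact hu
  | step _ _ h _ _ => exact h

lemma mem_set (hu : u.1 ∈ Y) (h : HistoryChain ω Y u j v) : v.1 ∈ Y := by
  cases h with
  | root => exact hu
  | step _ _ _ h _ => exact h

lemma mono (hY : Y ⊆ Y') (h : HistoryChain ω Y u j v) : HistoryChain ω Y' u j v := by
  induction h with
  | root => exact root
  | step _ h1 h2 h3 h4 ih => exact step ih h1 h2 (hY h3) h4

end HistoryChain

open Classical in
/-- The resamplings that are reached from `u` going back in time. -/
noncomputable def history (ω : I.Table) (Y : Set I.Event) (u : I.Event × ℕ) :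
    Finset (I.Event × ℕ) :=
  (Finset.univ ×ˢ Finset.range (u.2 + 1)).filter fun v => ∃ j, HistoryChain ω Y u j v

open Classical in
/-- The length of the longest chain from `u` to `v`. -/
noncomputable def level (ω : I.Table) (Y : Set I.Event) (u v : I.Event × ℕ) : ℕ :=
  Nat.findGreatest (fun j => HistoryChain ω Y u j v) u.2

section History

variable {ω : I.Table} {Y : Set I.Event} {u v w : I.Event × ℕ} {j : ℕ}

lemma mem_history : v ∈ history ω Y u ↔ ∃ j, HistoryChain ω Y u j v := by
  simp only [history, Finset.mem_filter, Finset.mem_product, Finset.mem_univ, Finset.mem_range,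
    true_and, and_iff_right_iff_imp]
  rintro ⟨j, hj⟩
  have := hj.time_le
  omega

lemma history_mono {Y' : Set I.Event} (hY : Y ⊆ Y') : history ω Y u ⊆ history ω Y' u := by
  intro v hv
  obtain ⟨j, hj⟩ := mem_history.1 hv
  exact mem_history.2 ⟨j, hj.mono hY⟩

lemma HistoryChain.le_level (h : HistoryChain ω Y u j v) : j ≤ level ω Y u v := by
  classical
  exact Nat.le_findGreatest (by have := h.time_le; omega) h

lemma historyChain_level (h : v ∈ history ω Y u) : HistoryChain ω Y u (level ω Y u v) v := by
  classical
  obtain ⟨j, hj⟩ := mem_history.1 h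
  exact Nat.findGreatest_spec (P := fun j => HistoryChain ω Y u j v)
    (by have := hj.time_le; omega) hj

/-- A longest chain to `v` can be extended by `w`. -/
lemma level_lt_level (hu : u.1 ∈ resampled ω u.2) (hY : u.1 ∈ Y) (hv : v ∈ history ω Y u)
    (hw : w ∈ history ω Y u) (ht : w.2 < v.2) (hn : Near v.1 w.1) :
    level ω Y u v < level ω Y u w :=
  ((historyChain_level hv).step ht ((historyChain_level hw).mem_resampled hu)
    ((historyChain_level hw).mem_set hY) hn).le_level

lemma near_symm {e f : I.Event} (h : Near e f) : Near f e := by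
  obtain ⟨k, hk, hk'⟩ := h
  exact ⟨k, hk'.imp id SimpleGraph.Adj.symm, hk.imp id SimpleGraph.Adj.symm⟩

lemma time_eq_of_level_eq (hu : u.1 ∈ resampled ω u.2) (hY : u.1 ∈ Y) (hv : v ∈ history ω Y u)
    (hw : w ∈ history ω Y u) (hl : level ω Y u v = level ω Y u w) (hn : Near v.1 w.1) :
    v.2 = w.2 := by
  rcases lt_trichotomy v.2 w.2 with h | h | h
  · exact absurd (level_lt_level hu hY hw hv h (near_symm hn)) (by omega)
  · exact h
  · exact absurd (level_lt_level hu hY hv hw h hn) (by omega)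

/-- The last step of a longest chain to `w` starts at level exactly `j`: a longer chain to that
point would yield a longer one to `w`. -/
lemma exists_level_pred (hw : w ∈ history ω Y u) (hl : level ω Y u w = j + 1) :
    ∃ v ∈ history ω Y u, level ω Y u v = j ∧ Near v.1 w.1 := by
  have h := historyChain_level hw
  rw [hl] at h
  cases h with
  | @step _ v _ h1 h2 h3 h4 h5 =>
    have hv : v ∈ history ω Y u := mem_history.2 ⟨j, h1⟩
    refine ⟨v, hv, le_antisymm ?_ h1.le_level, h5⟩
    have := ((historyChain_level hv).step h2 h3 h4 h5).le_level
    omega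

lemma eq_of_level_eq_zero (hw : w ∈ history ω Y u) (hl : level ω Y u w = 0) : w = u := by
  have h := historyChain_level hw
  rw [hl] at h
  cases h
  rfl

lemma level_le (hw : w ∈ history ω Y u) : level ω Y u w ≤ u.2 := by
  have := (historyChain_level hw).time_le
  omega

end History

open Classical in
/-- The number of occurrences of the variable `x` in the layers of `F` after the `j`-th one. -/
noncomputable def position {h : ℕ} (F : Fin h → Finset I.Event) (j : Fin h) (x : I.Var) : ℕ :=
  ∑ i with j < i, ((F i).filter fun g => x ∈ I.vbl g).card

open Classical in
/-- The `j`-th layer of the history of `u`. -/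
noncomputable def historyLayer (ω : I.Table) (Y : Set I.Event) (u : I.Event × ℕ) (j : ℕ) :
    Finset I.Event :=
  ((history ω Y u).filter fun v => level ω Y u v = j).image Prod.fst

section HistoryLayer

variable {ω : I.Table} {Y : Set I.Event} {u : I.Event × ℕ}

lemma mem_historyLayer {j : ℕ} {g : I.Event} :
    g ∈ historyLayer ω Y u j ↔ ∃ s, (g, s) ∈ history ω Y u ∧ level ω Y u (g, s) = j := by
  simp [historyLayer]

open Classical in
lemma card_filter_historyLayer (hu : u.1 ∈ resampled ω u.2) (hY : u.1 ∈ Y) (P : I.Event → Prop)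
    (j : ℕ) : ((historyLayer ω Y u j).filter P).card =
      ((history ω Y u).filter fun v => P v.1 ∧ level ω Y u v = j).card := by
  rw [historyLayer, Finset.filter_image, Finset.card_image_of_injOn, Finset.filter_filter]
  · simp only [and_comm]
  · intro v hv w hw hvw
    simp only [Finset.coe_filter, Finset.mem_filter, Set.mem_ofPred_eq] at hv hw
    -- Forgetting the round is injective on a layer, because an event occurs at most once on each
    -- level.
    refine Prod.ext hvw (time_eq_of_level_eq hu hY hv.1.1 hw.1.1 (hv.1.2.trans hw.1.2.symm) ?_)
    rw [show v.1 = w.1 from hvw]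
    exact near_refl _

open Classical in
lemma sum_card_filter_historyLayer (hu : u.1 ∈ resampled ω u.2) (hY : u.1 ∈ Y)
    (P : I.Event → Prop) {h : ℕ} (hh : u.2 < h) (c : ℕ → Prop) :
    ∑ i ∈ Finset.univ.filter (fun i : Fin h => c (i : ℕ)), ((historyLayer ω Y u (i : ℕ)).filter P).card =
      ((history ω Y u).filter fun v => P v.1 ∧ c (level ω Y u v)).card := by
  rw [Finset.card_eq_sum_card_fiberwise (f := fun v => level ω Y u v) (t := Finset.range h)
    (fun v hv => by
      simp only [Finset.coe_filter, Set.mem_ofPred_eq] at hv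
      simpa using (level_le hv.1).trans_lt hh), Finset.sum_range, Finset.sum_filter]
  refine Finset.sum_congr rfl fun i _ => ?_
  rw [Finset.filter_filter]
  split_ifs with hc
  · rw [card_filter_historyLayer hu hY]
    congr 1
    ext v
    simp only [Finset.mem_filter, and_congr_right_iff]
    intro _
    constructor
    · rintro ⟨h1, h2⟩
      exact ⟨⟨h1, h2 ▸ hc⟩, h2⟩
    · rintro ⟨⟨h1, -⟩, h2⟩
      exact ⟨h1, h2⟩
  · symm
    rw [Finset.card_eq_zero, Finset.filter_eq_empty_iff]
    rintro v - ⟨⟨-, h1⟩, h2⟩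
    exact hc (h2 ▸ h1)

/-- The layers of the history determine the entries of the table that were used. -/
lemma position_historyLayer (hu : u.1 ∈ resampled ω u.2) (hY : u.1 ∈ Y) {h : ℕ} (hh : u.2 < h)
    {g : I.Event} {s : ℕ} (hg : (g, s) ∈ history ω Y u)
    (hgY : ∀ f, g = f ∨ I.graph.Adj g f → f ∈ Y) {j : Fin h} (hj : level ω Y u (g, s) = j)
    {x : I.Var} (hx : x ∈ I.vbl g) :
    position (fun i : Fin h => historyLayer ω Y u i) j x = resampleCount ω s x := by
  classical
  have hgs := (historyChain_level hg).mem_resampled hu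
  have := sum_card_filter_historyLayer hu hY (fun f => x ∈ I.vbl f) hh (fun i => (j : ℕ) < i)
  have hpos : position (fun i : Fin h => historyLayer ω Y u i) j x = _ :=
    Eq.trans (by simp only [position, Fin.lt_def]; congr!) this
  rw [hpos, resampleCount_eq_card]
  congr 1
  ext ⟨f, s'⟩
  simp only [Finset.mem_filter, Finset.mem_product, Finset.mem_univ, Finset.mem_range, true_and]
  -- The deeper occurrences of `x` are exactly its earlier resamplings. A later one would have a
  -- smaller level, and one in the same round would be `g` itself. Conversely, an event resampling
  -- `x` before round `s` equals or neighbours `g`, so it lies in `Y` and extends the chain to `(g,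
  -- s)`.
  constructor
  · rintro ⟨hf, hxf, hl⟩
    have hfs := (historyChain_level hf).mem_resampled hu
    refine ⟨?_, hfs, hxf⟩
    have hn := near_of_mem_vbl hxf hx
    rcases lt_trichotomy s' s with hs | hs | hs
    · exact hs
    · subst hs
      have : f = g := eq_of_mem_resampled hfs hgs hxf hx
      subst this
      omega
    · exact absurd (level_lt_level hu hY hf hg hs hn) (by omega)
  · rintro ⟨hs, hf, hxf⟩
    have hn := near_of_mem_vbl hx hxf
    have hmem : (f, s') ∈ history ω Y u := mem_history.2
      ⟨_, (historyChain_level hg).step hs hf (hgY f (eq_or_adj_of_mem_vbl hx hxf)) hn⟩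
    refine ⟨hmem, hxf, ?_⟩
    have := level_lt_level hu hY hg hmem hs hn
    omega

end HistoryLayer

end LLLInstance

/-! ### Witnesses and their probability -/

namespace LLLInstance

variable {S : Type u} [MeasurableSpace S] {I : LLLInstance.{u, v, w} S}

/-- A layered sequence of events, contained in `Y`, that is consistent with the randomness table as
far as the events in `Z` are concerned. -/
structure IsWitness (ω : I.Table) (Z Y : Set I.Event) (e : I.Event) {h : ℕ}
    (F : Fin h → Finset I.Event) : Prop where
  layered : IsLayered Near h {e} F
  mem : ∀ j, ∀ g ∈ F j, g ∈ Y
  indep : ∀ j, ∀ f ∈ F j, ∀ g ∈ F j, ¬ I.graph.Adj f g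
  bad : ∀ j, ∀ g ∈ F j, g ∈ Z → current ω (position F j) ∈ I.bad g

/-- The total size of the layers. -/
def layersCard {h : ℕ} (F : Fin h → Finset I.Event) : ℕ := ∑ j, (F j).card

open Classical in
/-- The number of elements of the layers that belong to `Z`. -/
noncomputable def checkedCard {h : ℕ} (F : Fin h → Finset I.Event) (Z : Set I.Event) : ℕ :=
  ∑ j, ((F j).filter (· ∈ Z)).card

lemma position_lt_position {h : ℕ} {F : Fin h → Finset I.Event} {i j : Fin h} (hij : i < j)
    {g : I.Event} (hg : g ∈ F j) {x : I.Var} (hx : x ∈ I.vbl g) :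
    position F j x < position F i x := by
  classical
  unfold position
  refine Finset.sum_lt_sum_of_subset (i := j) ?_ (by simpa using hij) (by simp) ?_ (by simp)
  · intro k hk
    simp only [Finset.mem_filter, Finset.mem_univ, true_and] at hk ⊢
    exact hij.trans hk
  · exact Finset.card_pos.2 ⟨g, by simp [hg, hx]⟩

/-- The checked members read pairwise disjoint sets of entries: in one layer they share no
variables, and in different layers a shared variable has different positions. The probabilities
therefore multiply. -/
lemma tableLaw_forall_bad_le {p : ℝ}
    (hp : ∀ e, Measure.infinitePi I.law (I.bad e) ≤ ENNReal.ofReal p) {h : ℕ}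
    {F : Fin h → Finset I.Event} (hF : ∀ j, ∀ f ∈ F j, ∀ g ∈ F j, ¬ I.graph.Adj f g)
    (Z : Set I.Event) :
    I.tableLaw {ω | ∀ j, ∀ g ∈ F j, g ∈ Z → current ω (position F j) ∈ I.bad g} ≤
      ENNReal.ofReal p ^ checkedCard F Z := by
  classical
  set s : Finset (Σ _ : Fin h, I.Event) :=
    Finset.univ.sigma fun j => (F j).filter (· ∈ Z) with hs
  have hmem : ∀ q : Σ _ : Fin h, I.Event, q ∈ s ↔ q.2 ∈ F q.1 ∧ q.2 ∈ Z := by simp [hs]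
  have hset : {ω | ∀ j, ∀ g ∈ F j, g ∈ Z → current ω (position F j) ∈ I.bad g} =
      ⋂ q ∈ s, {ω : I.Table | current ω (position F q.1) ∈ I.bad q.2} := by
    ext ω
    simp only [Set.mem_ofPred_eq, Set.mem_iInter, hmem, Sigma.forall]
    tauto
  have hcard : s.card = checkedCard F Z := by simp [hs, checkedCard]
  rw [hset, I.tableLaw_biInter_eq_prod s
    (fun q _ => measurableSet_current_mem_bad q.2 (position F q.1)), ← hcard]
  · refine Finset.prod_le_pow_card _ _ _ fun q _ => ?_
    rw [tableLaw_current_mem_bad]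
    exact hp _
  · rintro ⟨i, f⟩ hf ⟨j, g⟩ hg hne
    rw [hmem] at hf hg
    rw [Set.disjoint_left]
    rintro ⟨x, k⟩ ⟨hxf, hkf⟩ ⟨hxg, hkg⟩
    simp only at hf hg hxf hkf hxg hkg
    rcases lt_trichotomy i j with hij | rfl | hij
    · have := position_lt_position hij hg.1 hxg
      omega
    · exact hF i f hf.1 g hg.1 ⟨fun h => hne (by rw [h]), x, hxf, hxg⟩
    · have := position_lt_position hij hf.1 hxf
      omega

lemma near_iff_edist_le {e f : I.Event} : Near e f ↔ I.graph.edist e f ≤ (2 : ℕ) := by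
  constructor
  · intro h
    have := h.mem_ball (mem_ball_self e 0)
    simpa [ball] using this
  · intro h
    obtain ⟨g, hg, hgf⟩ := I.graph.edist_le_add_one_iff (r := 1) |>.1 h
    obtain ⟨k, hk, hkg⟩ := I.graph.edist_le_add_one_iff (r := 0) |>.1 hg
    have : e = k := by simpa using hk
    subst this
    exact ⟨g, hkg.imp Eq.symm id, hgf⟩

open Classical in
lemma card_near_le {d : ℕ} (hd : ∀ e, (I.graph.neighborSet e).ncard ≤ d) (e : I.Event) :
    (Finset.univ.filter fun f => Near e f).card ≤ (d + 1) ^ 2 := by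
  have h := I.graph.ncard_edist_le hd e 2
  rw [Set.ncard_eq_toFinset_card'] at h
  convert h using 2
  ext f
  simp [near_iff_edist_le]

/-- The base of the exponential bound for the probability that a large witness exists. -/
noncomputable def witnessRate (d : ℕ) (p ε : ℝ) : ℝ := p * (3 * ((d : ℝ) + 1) ^ 2) ^ (1 + ε)

/-- Union bound over layered sequences. With `B = 3 * (d + 1) ^ 2`, the cap on the total size lets
`p ^ checkedCard` pay for the weight `B ^ (-layersCard)` of the count, and `witnessRate ^ K` is left
over. -/
theorem tableLaw_exists_witness_le {d : ℕ} {p ε : ℝ} (hp0 : 0 ≤ p)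
    (hd : ∀ e, (I.graph.neighborSet e).ncard ≤ d)
    (hp : ∀ e, Measure.infinitePi I.law (I.bad e) ≤ ENNReal.ofReal p)
    (hrate : witnessRate d p ε ≤ 1) (Z Y : Set I.Event) (e : I.Event) (h K : ℕ) :
    I.tableLaw {ω | ∃ F : Fin h → Finset I.Event, IsWitness ω Z Y e F ∧ K ≤ checkedCard F Z ∧
      (layersCard F : ℝ) ≤ (1 + ε) * checkedCard F Z} ≤
      ENNReal.ofReal (3 * witnessRate d p ε ^ K) := by
  classical
  set θ := witnessRate d p ε with hθ
  set B : ℝ := 3 * ((d : ℝ) + 1) ^ 2 with hB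
  have hB1 : 1 ≤ B := by
    have : (1 : ℝ) ≤ ((d : ℝ) + 1) ^ 2 := one_le_pow₀ (by simp)
    linarith
  have hθ0 : 0 ≤ θ := mul_nonneg hp0 (by positivity)
  set T : Finset (Fin h → Finset I.Event) := Finset.univ.filter fun F =>
    IsLayered Near h {e} F ∧ (∀ j, ∀ f ∈ F j, ∀ g ∈ F j, ¬ I.graph.Adj f g) ∧
      K ≤ checkedCard F Z ∧ (layersCard F : ℝ) ≤ (1 + ε) * checkedCard F Z with hT
  have hsub : {ω | ∃ F : Fin h → Finset I.Event, IsWitness ω Z Y e F ∧ K ≤ checkedCard F Z ∧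
      (layersCard F : ℝ) ≤ (1 + ε) * checkedCard F Z} ⊆
      ⋃ F ∈ T, {ω | ∀ j, ∀ g ∈ F j, g ∈ Z → current ω (position F j) ∈ I.bad g} := by
    rintro ω ⟨F, hF, hK, hc⟩
    simp only [Set.mem_iUnion]
    exact ⟨F, by simp [hT, hF.layered, hK, hc]; exact hF.indep, hF.bad⟩
  have hterm : ∀ F ∈ T, p ^ checkedCard F Z ≤ (1 / B) ^ (∑ j, (F j).card) * θ ^ K := by
    intro F hF
    obtain ⟨-, -, hK, hc⟩ := (Finset.mem_filter.1 hF).2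
    have h1 : B ^ layersCard F ≤ B ^ ((1 + ε) * checkedCard F Z) := by
      rw [← Real.rpow_natCast]
      exact Real.rpow_le_rpow_of_exponent_le hB1 hc
    have h2 : θ ^ checkedCard F Z ≤ θ ^ K := pow_le_pow_of_le_one hθ0 hrate hK
    have h3 : θ ^ checkedCard F Z = p ^ checkedCard F Z * B ^ ((1 + ε) * checkedCard F Z) := by
      rw [hθ, witnessRate, mul_pow, Real.rpow_mul (by positivity), Real.rpow_natCast]
    change _ ≤ (1 / B) ^ layersCard F * θ ^ K
    rw [one_div, inv_pow, ← div_eq_inv_mul, le_div_iff₀ (by positivity)]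
    calc p ^ checkedCard F Z * B ^ layersCard F
        ≤ p ^ checkedCard F Z * B ^ ((1 + ε) * checkedCard F Z) := by gcongr
      _ ≤ θ ^ K := h3 ▸ h2
  calc _ ≤ I.tableLaw (⋃ F ∈ T,
        {ω | ∀ j, ∀ g ∈ F j, g ∈ Z → current ω (position F j) ∈ I.bad g}) := measure_mono hsub
    _ ≤ ∑ F ∈ T, I.tableLaw
        {ω | ∀ j, ∀ g ∈ F j, g ∈ Z → current ω (position F j) ∈ I.bad g} :=
      measure_biUnion_finset_le _ _
    _ ≤ ∑ F ∈ T, ENNReal.ofReal ((1 / B) ^ (∑ j, (F j).card) * θ ^ K) := by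
      refine Finset.sum_le_sum fun F hF => ?_
      refine (tableLaw_forall_bad_le hp (Finset.mem_filter.1 hF).2.2.1 Z).trans ?_
      rw [← ENNReal.ofReal_pow hp0]
      exact ENNReal.ofReal_le_ofReal (hterm F hF)
    _ = ENNReal.ofReal (∑ F ∈ T, (1 / B) ^ (∑ j, (F j).card) * θ ^ K) :=
      (ENNReal.ofReal_sum_of_nonneg fun _ _ => by positivity).symm
    _ ≤ ENNReal.ofReal (3 * θ ^ K) := by
      refine ENNReal.ofReal_le_ofReal ?_
      rw [← Finset.sum_mul]
      refine mul_le_mul_of_nonneg_right ?_ (by positivity)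
      have := sum_isLayered_le (N := Near (I := I)) (D := (d + 1) ^ 2)
        (Nat.one_le_pow _ _ (by omega)) (card_near_le hd) h {e}
      push_cast at this
      rw [Finset.card_singleton, pow_one] at this
      refine le_trans (Finset.sum_le_sum_of_subset_of_nonneg ?_ fun _ _ _ => by positivity) this
      exact Finset.monotone_filter_right _ fun F _ hF => hF.1

/-- The history of a resampling is a witness. -/
lemma isWitness_historyLayer {ω : I.Table} {Z Y : Set I.Event} {u : I.Event × ℕ} {e : I.Event}
    (hu : u.1 ∈ resampled ω u.2) (hY : u.1 ∈ Y) (he : Near e u.1)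
    (hZ : ∀ g ∈ Z, ∀ f, g = f ∨ I.graph.Adj g f → f ∈ Y) {h : ℕ} (hh : u.2 < h) :
    IsWitness ω Z Y e (fun j : Fin h => historyLayer ω Y u j) where
  layered := by
    -- The layers are preceded by `{e}`, so level `j` is layer `j + 1` of the auxiliary sequence;
    -- the only member of level zero is `u`, which is near `e`.
    have := isLayered_of_forall (N := Near (I := I))
      (fun j => Nat.casesOn j {e} fun j => historyLayer ω Y u j) (fun j f hf => ?_) h 0
    · have h0 : ∀ j : Fin h, 0 + 1 + (j : ℕ) = j + 1 := fun j => by omega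
      simp only [h0] at this
      exact this
    · obtain ⟨s, hs, hl⟩ := mem_historyLayer.1 hf
      cases j with
      | zero =>
        have := eq_of_level_eq_zero hs hl
        exact ⟨e, Finset.mem_singleton_self e, by subst this; exact he⟩
      | succ j =>
        obtain ⟨v, hv, hvl, hn⟩ := exists_level_pred hs hl
        exact ⟨v.1, mem_historyLayer.2 ⟨v.2, hv, hvl⟩, hn⟩
  mem j g hg := by
    obtain ⟨s, hs, -⟩ := mem_historyLayer.1 hg
    exact (historyChain_level hs).mem_set hY
  indep j f hf g hg hfg := by
    obtain ⟨s, hs, hl⟩ := mem_historyLayer.1 hf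
    obtain ⟨s', hs', hl'⟩ := mem_historyLayer.1 hg
    obtain ⟨hne, x, hxf, hxg⟩ := hfg
    have := time_eq_of_level_eq hu hY hs hs' (hl.trans hl'.symm) (near_of_mem_vbl hxf hxg)
    simp only at this
    subst this
    exact hne (eq_of_mem_resampled ((historyChain_level hs).mem_resampled hu)
      ((historyChain_level hs').mem_resampled hu) hxf hxg)
  bad j g hg hgZ := by
    obtain ⟨s, hs, hl⟩ := mem_historyLayer.1 hg
    have hgs := ((historyChain_level hs).mem_resampled hu).1
    refine (iff_of_eq (I.dependsOn_bad g fun x hx => ?_)).1 hgs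
    simp only [current]
    rw [position_historyLayer hu hY hh hs (hZ g hgZ) hl hx]

open Classical in
lemma checkedCard_historyLayer {ω : I.Table} {Y : Set I.Event} {u : I.Event × ℕ}
    (hu : u.1 ∈ resampled ω u.2) (hY : u.1 ∈ Y) (Z : Set I.Event) {h : ℕ} (hh : u.2 < h) :
    checkedCard (fun j : Fin h => historyLayer ω Y u j) Z =
      ((history ω Y u).filter fun v => v.1 ∈ Z).card := by
  have := sum_card_filter_historyLayer hu hY (fun f => f ∈ Z) hh (fun _ => True)
  simpa [checkedCard] using this

lemma layersCard_historyLayer {ω : I.Table} {Y : Set I.Event} {u : I.Event × ℕ}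
    (hu : u.1 ∈ resampled ω u.2) (hY : u.1 ∈ Y) {h : ℕ} (hh : u.2 < h) :
    layersCard (fun j : Fin h => historyLayer ω Y u j) = (history ω Y u).card := by
  classical
  have := checkedCard_historyLayer hu hY Set.univ hh
  simpa [checkedCard, layersCard] using this

end LLLInstance

/-! ### Insecure events, and why secure events settle early -/

namespace LLLInstance

variable {S : Type u} [MeasurableSpace S]

/-- An event is insecure if it has a large witness most of whose events are far enough from the
boundary of a ball. -/
def Insecure (K J h : ℕ) (ε : ℝ) : EventProperty.{u, v, w} S := fun I ω e =>
  ∃ i ≤ J, ∃ F : Fin h → Finset I.Event,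
    IsWitness ω (I.ball e (2 * K + 2 * i)) (I.ball e (2 * K + 2 * i + 2)) e F ∧
      K ≤ checkedCard F (I.ball e (2 * K + 2 * i)) ∧
      (layersCard F : ℝ) ≤ (1 + ε) * checkedCard F (I.ball e (2 * K + 2 * i))

variable {I : LLLInstance.{u, v, w} S}

lemma exists_historyChain {ω : I.Table} {Y : Set I.Event} {e f : I.Event} {t : ℕ}
    (hf : f ∈ resampled ω t) (he : Near e f) (i : ℕ) (hi : i ≤ t) (hY : I.ball e (2 * i + 2) ⊆ Y) :
    ∃ g ∈ I.ball e (2 * i + 2), HistoryChain ω Y (f, t) i (g, t - i) := by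
  induction i with
  | zero => exact ⟨f, by simpa using he.mem_ball (mem_ball_self e 0), HistoryChain.root⟩
  | succ i ih =>
    obtain ⟨g, hg, hc⟩ := ih (by omega) ((ball_subset_ball (by omega)).trans hY)
    have hgt := hc.mem_resampled hf
    simp only [show t - i = t - (i + 1) + 1 by omega] at hgt
    obtain ⟨k, hk, hgk⟩ := exists_near_resampled hgt
    have hkb : k ∈ I.ball e (2 * (i + 1) + 2) := hgk.mem_ball hg
    exact ⟨k, hkb, hc.step (by simp only; omega) hk (hY hkb) hgk⟩

-- Each of the rounds `t, t - 1, …, t - K + 1` contributes a member within distance `2 * K` of `e`,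
-- since one step back in time moves by at most two.
open Classical in
lemma le_card_history {ω : I.Table} {Y Z : Set I.Event} {e f : I.Event} {t K : ℕ}
    (hf : f ∈ resampled ω t) (he : Near e f) (hK : K ≤ t + 1) (hZ : I.ball e (2 * K) ⊆ Z)
    (hZY : Z ⊆ Y) : K ≤ ((history ω Y (f, t)).filter fun v => v.1 ∈ Z).card := by
  have H : ∀ i < K, ∃ g, g ∈ Z ∧ (g, t - i) ∈ history ω Y (f, t) := by
    intro i hi
    have hsub : I.ball e (2 * i + 2) ⊆ Z := (ball_subset_ball (by omega)).trans hZ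
    obtain ⟨g, hg, hc⟩ := exists_historyChain hf he i (by omega) (hsub.trans hZY)
    exact ⟨g, hsub hg, mem_history.2 ⟨i, hc⟩⟩
  have hsurj : (Finset.range K).image (fun i => t - i) ⊆
      ((history ω Y (f, t)).filter fun v => v.1 ∈ Z).image Prod.snd := by
    intro s hs
    obtain ⟨i, hi, rfl⟩ := Finset.mem_image.1 hs
    obtain ⟨g, hg, hh⟩ := H i (Finset.mem_range.1 hi)
    exact Finset.mem_image.2 ⟨(g, t - i), Finset.mem_filter.2 ⟨hh, hg⟩, rfl⟩
  have hcard : ((Finset.range K).image (fun i => t - i)).card = K := by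
    rw [Finset.card_image_of_injOn, Finset.card_range]
    intro i hi j hj hij
    simp only [Finset.coe_range, Set.mem_Iio] at hi hj hij
    omega
  calc K = _ := hcard.symm
    _ ≤ _ := Finset.card_le_card hsurj
    _ ≤ _ := Finset.card_image_le

lemma resampled_eq_empty_of_le {ω : I.Table} {s t : ℕ} (hst : s ≤ t)
    (h : resampled ω s = ∅) : resampled ω t = ∅ := by
  induction t, hst using Nat.le_induction with
  | base => exact h
  | succ t _ ih =>
    rw [Set.eq_empty_iff_forall_notMem] at ih ⊢
    intro f hf
    obtain ⟨g, hg, -⟩ := exists_near_resampled hf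
    exact ih g hg

lemma exists_resampled_of_not_fixedAfter {ω : I.Table} {T : ℕ} {e : I.Event}
    (h : ¬ FixedAfter ω T e) : ∃ t, T ≤ t ∧ ∃ f ∈ resampled ω t, Near e f := by
  classical
  by_contra! hcon
  refine h fun x hx t ht => ?_
  induction t, ht using Nat.le_induction with
  | base => rfl
  | succ t ht ih =>
    have : ¬ ∃ e ∈ resampled ω t, x ∈ I.vbl e := by
      rintro ⟨f, hf, hxf⟩
      exact hcon t ht f hf (near_of_mem_vbl hx hxf)
    rw [resampleCount_succ, if_neg this, ih, add_zero]

lemma FixedAfter.mono {ω : I.Table} {T T' : ℕ} {e : I.Event} (h : FixedAfter ω T e)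
    (hT : T ≤ T') : FixedAfter ω T' e := fun x hx t ht =>
  (h x hx t (hT.trans ht)).trans (h x hx T' hT).symm

/-- There is no large witness in the whole graph. -/
def NoLargeWitness (M : ℕ) (ω : I.Table) : Prop :=
  ∀ (e : I.Event) (F : Fin (M + 1) → Finset I.Event), IsWitness ω Set.univ Set.univ e F →
    checkedCard F Set.univ ≤ M

lemma NoLargeWitness.card_history_le {M : ℕ} {ω : I.Table} (h : NoLargeWitness M ω)
    {f : I.Event} {t : ℕ} (hf : f ∈ resampled ω t) (ht : t ≤ M) :
    (history ω Set.univ (f, t)).card ≤ M := by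
  have hw := isWitness_historyLayer (Z := Set.univ) (u := (f, t)) hf (Set.mem_univ _) (near_refl f)
    (fun _ _ _ _ => Set.mem_univ _) (Nat.lt_succ_of_le ht)
  have := h f _ hw
  rw [checkedCard_historyLayer hf (Set.mem_univ _) _ (Nat.lt_succ_of_le ht)] at this
  simpa using this

/-- A resampling in round `M` or later forces one in round `M` itself, whose history reaches back
through `M + 1` rounds. -/
lemma NoLargeWitness.lt_of_mem_resampled {M : ℕ} {ω : I.Table} (h : NoLargeWitness M ω)
    {f : I.Event} {t : ℕ} (hf : f ∈ resampled ω t) : t < M := by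
  classical
  by_contra! hMt
  have hne : resampled ω M ≠ ∅ := fun he => by
    have := resampled_eq_empty_of_le hMt he
    simp [this] at hf
  obtain ⟨g, hg⟩ := Set.nonempty_iff_ne_empty.2 hne
  have h1 := h.card_history_le hg le_rfl
  have h2 := le_card_history (K := M + 1) hg (near_refl g) le_rfl (Set.subset_univ _)
    (subset_refl Set.univ)
  simp only [Set.mem_univ, Finset.filter_true] at h2
  omega

/-- Ball growing on histories: a resampling near `e` in round `K` or later has at least `K` checked
members in the smallest ball. If no ball yields a witness of insecurity, the size grows by `1 + ε`
at each of `J` enlargements and exceeds the global bound `M`. -/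
theorem NoLargeWitness.fixedAfter {M K J : ℕ} {ε : ℝ} {ω : I.Table} (h : NoLargeWitness M ω)
    (hε : 0 ≤ ε) (hK : 1 ≤ K) (hJ : (M : ℝ) < (1 + ε) ^ J) {e : I.Event}
    (he : ¬ Insecure K J (M + 1) ε I ω e) : FixedAfter ω K e := by
  classical
  by_contra hfix
  obtain ⟨t, htK, f, hf, hef⟩ := exists_resampled_of_not_fixedAfter hfix
  have htM := h.lt_of_mem_resampled hf
  set W : ℕ → Finset (I.Event × ℕ) := fun i =>
    history ω (I.ball e (2 * K + 2 * i + 2)) (f, t) with hW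
  set B : ℕ → ℕ := fun i => ((W i).filter fun v => v.1 ∈ I.ball e (2 * K + 2 * i)).card with hB
  have hfY : ∀ i, f ∈ I.ball e (2 * K + 2 * i + 2) := fun i =>
    ball_subset_ball (by omega) (hef.mem_ball (mem_ball_self e 0))
  have hKB : ∀ i, K ≤ B i := fun i =>
    le_card_history hf hef (by omega) (ball_subset_ball (by omega)) (ball_subset_ball (by omega))
  -- All members at stage `i`, checked or not, are checked at stage `i + 1`, because the outer ball
  -- of one stage is the inner ball of the next.
  have hWB : ∀ i, (W i).card ≤ B (i + 1) := by
    intro i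
    refine Finset.card_le_card fun v hv => Finset.mem_filter.2
      ⟨history_mono (ball_subset_ball (by omega)) hv, ?_⟩
    exact (historyChain_level hv).mem_set (hfY i)
  have hgrow : ∀ i ≤ J, (1 + ε) * B i < (W i).card := by
    intro i hi
    by_contra! hle
    refine he ⟨i, hi, fun j => historyLayer ω (I.ball e (2 * K + 2 * i + 2)) (f, t) j,
      isWitness_historyLayer hf (hfY i) hef ?_ (htM.trans (Nat.lt_succ_self M)), ?_, ?_⟩
    · intro g hg k hk
      exact ball_subset_ball (by omega) (mem_ball_succ_iff.2 ⟨g, hg, hk⟩)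
    · rw [checkedCard_historyLayer hf (hfY i) _ (htM.trans (Nat.lt_succ_self M))]
      exact hKB i
    · rw [checkedCard_historyLayer hf (hfY i) _ (htM.trans (Nat.lt_succ_self M)),
        layersCard_historyLayer hf (hfY i) (htM.trans (Nat.lt_succ_self M))]
      exact hle
  have hpow : ∀ i ≤ J, (1 + ε) ^ i ≤ (B i : ℝ) := by
    intro i
    induction i with
    | zero => intro _; simpa using hK.trans (hKB 0)
    | succ i ih =>
      intro hi
      calc (1 + ε) ^ (i + 1) = (1 + ε) * (1 + ε) ^ i := pow_succ' _ _
        _ ≤ (1 + ε) * B i := by gcongr; exact ih (by omega)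
        _ ≤ (W i).card := (hgrow i (by omega)).le
        _ ≤ B (i + 1) := by exact_mod_cast hWB i
  have hBM : B J ≤ M := ((Finset.card_filter_le _ _).trans
    (Finset.card_le_card (history_mono (Set.subset_univ _)))).trans (h.card_history_le hf htM.le)
  have : (B J : ℝ) ≤ M := by exact_mod_cast hBM
  linarith [hpow J le_rfl]

end LLLInstance

/-! ### Locality of insecurity -/

section Local

variable {S : Type u} [MeasurableSpace S]

open LLLInstance

lemma SameNeighborhood.symm {r : ℕ} {I I' : LLLInstance.{u, v, w} S} {ω : I.Table} {ω' : I'.Table}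
    {e : I.Event} {e' : I'.Event} (h : SameNeighborhood r I I' ω ω' e e') :
    SameNeighborhood r I' I ω' ω e' e := by
  obtain ⟨φ, ψ, h1, h2, h3, h4, h5, h6⟩ := h
  refine ⟨φ.symm, ψ.symm, fun f => ?_, fun f => ?_, fun x => ?_, fun f x => ?_, fun f a a' ha => ?_,
    fun x k => ?_⟩
  · have := h1 (φ.symm f); simpa using this.symm
  · have := h2 (φ.symm f); simpa using this.symm
  · have := h3 (ψ.symm x); simpa using this.symm
  · have := h4 (φ.symm f) (ψ.symm x); simpa using this.symm
  · have := h5 (φ.symm f) a' a (fun x => by have := ha (ψ x); simpa using this.symm)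
    simpa using this.symm
  · have := h6 (ψ.symm x) k; simpa using this.symm

variable {I I' : LLLInstance.{u, v, w} S} {ω : I.Table} {ω' : I'.Table} {e : I.Event}
  {e' : I'.Event} {ρ : ℕ}

/-- An isomorphism of neighbourhoods carries a witness to a witness. The radius exceeds that of the
largest outer ball by one, because the midpoint of a pair of near events may lie outside that ball.
-/
lemma Insecure.of_sameNeighborhood {K J h : ℕ} {ε : ℝ} (hρ : 2 * K + 2 * J + 3 ≤ ρ)
    (hs : SameNeighborhood ρ I I' ω ω' e e') (hi : Insecure K J h ε I ω e) :
    Insecure K J h ε I' ω' e' := by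
  classical
  obtain ⟨φ, ψ, hroot, -, -, hvbl, hbad, htab⟩ := hs
  obtain ⟨Φ, hΦ⟩ : ∃ Φ : I.Event → I'.Event, ∀ f : I.ball e ρ, Φ f.1 = (φ f).1 :=
    ⟨fun f => if hf : f ∈ I.ball e ρ then (φ ⟨f, hf⟩).1 else e', fun f => by simp⟩
  have hΦmem : ∀ f ∈ I.ball e ρ, Φ f ∈ I'.ball e' ρ := fun f hf => by
    rw [hΦ ⟨f, hf⟩]; exact (φ ⟨f, hf⟩).2
  have hinj : ∀ f ∈ I.ball e ρ, ∀ g ∈ I.ball e ρ, Φ f = Φ g → f = g := by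
    intro f hf g hg hfg
    rw [hΦ ⟨f, hf⟩, hΦ ⟨g, hg⟩] at hfg
    simpa using φ.injective (Subtype.ext hfg)
  have hsurj : ∀ f' ∈ I'.ball e' ρ, ∃ f ∈ I.ball e ρ, Φ f = f' := by
    intro f' hf'
    refine ⟨(φ.symm ⟨f', hf'⟩).1, (φ.symm ⟨f', hf'⟩).2, ?_⟩
    rw [hΦ]; simp
  have hΦe : Φ e = e' := by
    rw [hΦ ⟨e, mem_ball_self e ρ⟩]; exact (hroot ⟨e, mem_ball_self e ρ⟩).1 rfl
  have hvb : ∀ f ∈ I.ball e ρ, ∀ x : I.ballVars e ρ, x.1 ∈ I.vbl f ↔ (ψ x).1 ∈ I'.vbl (Φ f) :=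
    fun f hf x => by rw [hΦ ⟨f, hf⟩]; exact hvbl ⟨f, hf⟩ x
  have hadj : ∀ f ∈ I.ball e ρ, ∀ g ∈ I.ball e ρ,
      (I.graph.Adj f g ↔ I'.graph.Adj (Φ f) (Φ g)) := by
    intro f hf g hg
    constructor
    · rintro ⟨hne, x, hxf, hxg⟩
      exact ⟨fun h => hne (hinj f hf g hg h), (ψ ⟨x, f, hf, hxf⟩).1,
        (hvb f hf ⟨x, f, hf, hxf⟩).1 hxf, (hvb g hg ⟨x, f, hf, hxf⟩).1 hxg⟩
    · rintro ⟨hne, x, hxf, hxg⟩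
      set y := ψ.symm ⟨x, Φ f, hΦmem f hf, hxf⟩ with hy
      have hyx : (ψ y).1 = x := by simp [hy]
      exact ⟨fun h => hne (h ▸ rfl), y.1, (hvb f hf y).2 (hyx ▸ hxf), (hvb g hg y).2 (hyx ▸ hxg)⟩
  -- Distances from the centre up to `ρ` are preserved, since the radius can be built up one edge at
  -- a time inside the ball.
  have hball : ∀ k ≤ ρ, ∀ f ∈ I.ball e ρ, (f ∈ I.ball e k ↔ Φ f ∈ I'.ball e' k) := by
    intro k
    induction k with
    | zero =>
      intro _ f hf
      have h0 : ∀ {I : LLLInstance.{u, v, w} S} {e f : I.Event}, e = f ↔ f ∈ I.ball e 0 := by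
        intro I e f
        simp only [ball, Nat.cast_zero, nonpos_iff_eq_zero, SimpleGraph.edist_eq_zero_iff,
          Set.mem_ofPred_eq]
      rw [← h0, ← h0, ← hΦe]
      exact ⟨fun h => h ▸ rfl, hinj e (mem_ball_self e ρ) f hf⟩
    | succ k ih =>
      intro hk f hf
      rw [mem_ball_succ_iff, mem_ball_succ_iff]
      constructor
      · rintro ⟨g, hg, hgf⟩
        have hgρ := ball_subset_ball (show k ≤ ρ by omega) hg
        exact ⟨Φ g, (ih (by omega) g hgρ).1 hg, hgf.imp (congrArg Φ) (hadj g hgρ f hf).1⟩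
      · rintro ⟨g', hg', hgf⟩
        obtain ⟨g, hg, rfl⟩ := hsurj g' (ball_subset_ball (show k ≤ ρ by omega) hg')
        exact ⟨g, (ih (by omega) g hg).2 hg', hgf.imp (hinj g hg f hf) (hadj g hg f hf).2⟩
  obtain ⟨i, hiJ, F, hF, hK, hcard⟩ := hi
  set r := 2 * K + 2 * i with hr
  have hFρ : ∀ j, ∀ g ∈ F j, g ∈ I.ball e ρ := fun j g hg =>
    ball_subset_ball (by omega) (hF.mem j g hg)
  have hinjF : ∀ j, Set.InjOn Φ (F j) := fun j f hf g hg =>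
    hinj f (hFρ j f hf) g (hFρ j g hg)
  have hnear : ∀ f ∈ I.ball e (r + 2), ∀ g ∈ I.ball e (r + 2), Near f g → Near (Φ f) (Φ g) := by
    rintro f hf g hg ⟨k, hk, hkg⟩
    have hkρ : k ∈ I.ball e ρ := ball_subset_ball (show r + 2 + 1 ≤ ρ by omega)
      (mem_ball_succ_iff.2 ⟨f, hf, hk.imp Eq.symm id⟩)
    have hfρ := ball_subset_ball (show r + 2 ≤ ρ by omega) hf
    have hgρ := ball_subset_ball (show r + 2 ≤ ρ by omega) hg
    exact ⟨Φ k, hk.imp (congrArg Φ) (hadj f hfρ k hkρ).1,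
      hkg.imp (congrArg Φ) (hadj k hkρ g hgρ).1⟩
  have hpos : ∀ (j : Fin h) (x : I.ballVars e ρ),
      position (fun j => (F j).image Φ) j (ψ x).1 = position F j x.1 := by
    intro j x
    unfold position
    refine Finset.sum_congr rfl fun i _ => ?_
    rw [Finset.filter_image, Finset.card_image_of_injOn
      ((hinjF i).mono (Finset.coe_subset.2 (Finset.filter_subset _ _)))]
    congr 1
    refine Finset.filter_congr fun g hg => (hvb g (hFρ i g hg) x).symm
  have hchk : checkedCard (fun j => (F j).image Φ) (I'.ball e' r) =
      checkedCard F (I.ball e r) := by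
    unfold checkedCard
    refine Finset.sum_congr rfl fun i _ => ?_
    rw [Finset.filter_image, Finset.card_image_of_injOn
      ((hinjF i).mono (Finset.coe_subset.2 (Finset.filter_subset _ _)))]
    congr 1
    refine Finset.filter_congr fun g hg => (hball r (by omega) g (hFρ i g hg)).symm
  have hlay : layersCard (fun j => (F j).image Φ) = layersCard F :=
    Finset.sum_congr rfl fun i _ => Finset.card_image_of_injOn (hinjF i)
  refine ⟨i, hiJ, fun j => (F j).image Φ, ⟨?_, ?_, ?_, ?_⟩, hchk ▸ hK, by rw [hchk, hlay]; exact hcard⟩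
  · have := hF.layered.image Φ (I.ball e (r + 2)) hnear
      (by simpa using mem_ball_self e (r + 2)) hF.mem
    simpa [hΦe] using this
  · intro j g' hg'
    obtain ⟨g, hg, rfl⟩ := Finset.mem_image.1 hg'
    exact (hball (r + 2) (by omega) g (hFρ j g hg)).1 (hF.mem j g hg)
  · intro j f' hf' g' hg'
    obtain ⟨g, hg, rfl⟩ := Finset.mem_image.1 hg'
    obtain ⟨f, hf, rfl⟩ := Finset.mem_image.1 hf'
    rw [← hadj f (hFρ j f hf) g (hFρ j g hg)]
    exact hF.indep j f hf g hg
  · intro j g' hg' hgr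
    obtain ⟨g, hg, rfl⟩ := Finset.mem_image.1 hg'
    have hgρ := hFρ j g hg
    rw [hΦ ⟨g, hgρ⟩]
    refine (hbad ⟨g, hgρ⟩ _ _ fun x => ?_).1
      (hF.bad j g hg ((hball r (by omega) g hgρ).2 hgr))
    simp only [current]
    rw [hpos, htab]

lemma isLocal_insecure {K J h : ℕ} {ε : ℝ} (hρ : 2 * K + 2 * J + 3 ≤ ρ) :
    (Insecure.{u, v, w} (S := S) K J h ε).IsLocal ρ := fun _ _ _ _ _ _ hs =>
  ⟨Insecure.of_sameNeighborhood hρ hs, Insecure.of_sameNeighborhood hρ hs.symm⟩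

end Local

/-! ### Probability of insecurity and independence at large distance -/

namespace LLLInstance

variable {S : Type u} [MeasurableSpace S] {I : LLLInstance.{u, v, w} S}

/-- Only checked members read the table, and these lie in balls of radius at most `2 * K + 2 * J`;
for a fixed graph everything else is a finite combinatorial choice. -/
lemma measurableSet_insecure (K J h : ℕ) (ε : ℝ) (e : I.Event) :
    MeasurableSet[I.entrySigma {q | q.1 ∈ I.ballVars e (2 * K + 2 * J + 2)}]
      {ω | Insecure K J h ε I ω e} := by
  classical
  set r : ℕ → ℕ := fun i => 2 * K + 2 * i
  set T : ℕ → Finset (Fin h → Finset I.Event) := fun i => Finset.univ.filter fun F =>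
    (IsLayered Near h {e} F ∧ (∀ j, ∀ f ∈ F j, f ∈ I.ball e (r i + 2)) ∧
      ∀ j, ∀ f ∈ F j, ∀ g ∈ F j, ¬ I.graph.Adj f g) ∧ K ≤ checkedCard F (I.ball e (r i)) ∧
      (layersCard F : ℝ) ≤ (1 + ε) * checkedCard F (I.ball e (r i)) with hT
  have hset : {ω | Insecure K J h ε I ω e} = ⋃ i ∈ Finset.range (J + 1), ⋃ F ∈ T i,
      ⋂ j ∈ (Finset.univ : Finset (Fin h)), ⋂ g ∈ (F j).filter (· ∈ I.ball e (r i)),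
        {ω | current ω (position F j) ∈ I.bad g} := by
    ext ω
    simp only [Set.mem_iUnion, Set.mem_iInter, Finset.mem_range, Finset.mem_univ, true_imp_iff,
      Finset.mem_filter, and_imp, exists_prop, hT, true_and, Set.mem_ofPred_eq]
    constructor
    · rintro ⟨i, hi, F, hF, hK, hc⟩
      exact ⟨i, by omega, F, ⟨⟨hF.layered, hF.mem, hF.indep⟩, hK, hc⟩, hF.bad⟩
    · rintro ⟨i, hi, F, ⟨⟨h1, h2, h3⟩, hK, hc⟩, h4⟩
      exact ⟨i, by omega, F, ⟨h1, h2, h3, h4⟩, hK, hc⟩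
  rw [hset]
  refine @Finset.measurableSet_biUnion _ _ (I.entrySigma _) _ _ fun i hi => ?_
  refine @Finset.measurableSet_biUnion _ _ (I.entrySigma _) _ _ fun F _ => ?_
  refine @Finset.measurableSet_biInter _ _ (I.entrySigma _) _ _ fun j _ => ?_
  refine @Finset.measurableSet_biInter _ _ (I.entrySigma _) _ _ fun g hg => ?_
  refine I.entrySigma_mono ?_ _ (measurableSet_current_mem_bad g (position F j))
  rintro ⟨x, k⟩ ⟨hx, -⟩
  refine ⟨g, ball_subset_ball ?_ (Finset.mem_filter.1 hg).2, hx⟩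
  have := Finset.mem_range.1 hi
  simp only [r]
  omega

theorem tableLaw_insecure_le {d : ℕ} {p ε : ℝ} (hp0 : 0 ≤ p)
    (hd : ∀ e, (I.graph.neighborSet e).ncard ≤ d)
    (hp : ∀ e, Measure.infinitePi I.law (I.bad e) ≤ ENNReal.ofReal p)
    (hrate : witnessRate d p ε ≤ 1) (e : I.Event) (K J h : ℕ) :
    I.tableLaw {ω | Insecure K J h ε I ω e} ≤
      ENNReal.ofReal ((J + 1) * (3 * witnessRate d p ε ^ K)) := by
  have hθ0 : 0 ≤ witnessRate d p ε := mul_nonneg hp0 (by positivity)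
  calc I.tableLaw {ω | Insecure K J h ε I ω e}
      ≤ I.tableLaw (⋃ i ∈ Finset.range (J + 1), {ω | ∃ F : Fin h → Finset I.Event,
          IsWitness ω (I.ball e (2 * K + 2 * i)) (I.ball e (2 * K + 2 * i + 2)) e F ∧
          K ≤ checkedCard F (I.ball e (2 * K + 2 * i)) ∧
          (layersCard F : ℝ) ≤ (1 + ε) * checkedCard F (I.ball e (2 * K + 2 * i))}) := by
        refine measure_mono ?_
        rintro ω ⟨i, hi, hF⟩
        simp only [Set.mem_iUnion]
        exact ⟨i, Finset.mem_range.2 (by omega), hF⟩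
    _ ≤ ∑ _i ∈ Finset.range (J + 1), ENNReal.ofReal (3 * witnessRate d p ε ^ K) :=
        (measure_biUnion_finset_le _ _).trans (Finset.sum_le_sum fun i _ =>
          tableLaw_exists_witness_le hp0 hd hp hrate _ _ e h K)
    _ = ENNReal.ofReal ((J + 1) * (3 * witnessRate d p ε ^ K)) := by
        rw [Finset.sum_const, Finset.card_range, nsmul_eq_mul, ← Nat.cast_add_one,
          ENNReal.ofReal_mul (Nat.cast_nonneg _), ENNReal.ofReal_natCast]

/-- The events in `Q` are pairwise at distance more than `2 * R + 1`. -/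
def IsSeparated (R : ℕ) (Q : Finset I.Event) : Prop :=
  ∀ e ∈ Q, ∀ f ∈ Q, e ≠ f → ¬ I.graph.edist e f ≤ (2 * R + 1 : ℕ)

/-- A common variable would link the two balls by at most one edge, giving distance at most `R + 1 +
R`. -/
lemma disjoint_ballVars {e f : I.Event} {R : ℕ} (h : ¬ I.graph.edist e f ≤ (2 * R + 1 : ℕ)) :
    Disjoint (I.ballVars e R) (I.ballVars f R) := by
  rw [Set.disjoint_left]
  rintro x ⟨g, hg, hxg⟩ ⟨k, hk, hxk⟩
  apply h
  have hgk : I.graph.edist g k ≤ 1 := by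
    rcases eq_or_adj_of_mem_vbl hxg hxk with rfl | h
    · simp
    · exact (SimpleGraph.edist_eq_one_iff_adj.2 h).le
  calc I.graph.edist e f ≤ I.graph.edist e g + I.graph.edist g f := SimpleGraph.edist_triangle
    _ ≤ I.graph.edist e g + (I.graph.edist g k + I.graph.edist k f) := by
      gcongr; exact SimpleGraph.edist_triangle
    _ ≤ R + (1 + R) := by
      gcongr
      · exact hg
      · rw [SimpleGraph.edist_comm]; exact hk
    _ = (2 * R + 1 : ℕ) := by push_cast; ring

theorem tableLaw_forall_insecure_le {K J h : ℕ} {ε q : ℝ}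
    (hq : ∀ e : I.Event, I.tableLaw {ω | Insecure K J h ε I ω e} ≤ ENNReal.ofReal q)
    {Q : Finset I.Event} (hQ : IsSeparated (2 * K + 2 * J + 2) Q) :
    I.tableLaw {ω | ∀ e ∈ Q, Insecure K J h ε I ω e} ≤ ENNReal.ofReal q ^ Q.card := by
  have hset : {ω | ∀ e ∈ Q, Insecure K J h ε I ω e} =
      ⋂ e ∈ Q, {ω | Insecure K J h ε I ω e} := by
    ext ω; simp
  rw [hset, I.tableLaw_biInter_eq_prod Q (fun e _ => measurableSet_insecure K J h ε e)]
  · exact Finset.prod_le_pow_card _ _ _ fun e _ => hq e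
  · intro e he f hf hne
    have := disjoint_ballVars (hQ e he f hf hne)
    rw [Set.disjoint_left] at this ⊢
    exact fun q hq hq' => this hq hq'

end LLLInstance

/-! ### Edge counts and proximity graphs -/

namespace SimpleGraph

variable {V : Type*} (G : SimpleGraph V)

/-- A path has one vertex more than its length, all distinct and all reachable from `u`. -/
lemma Reachable.edist_lt_ncard [Finite V] {u v : V} (h : G.Reachable u v) :
    G.edist u v < ({w | G.Reachable u w}.ncard : ℕ) := by
  classical
  obtain ⟨p, hp⟩ := h.exists_isPath
  refine (edist_le p).trans_lt (Nat.cast_lt.2 ?_)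
  rw [← Nat.succ_le_iff, Nat.succ_eq_add_one, ← Walk.length_support,
    ← List.toFinset_card_of_nodup hp.support_nodup, ← Set.ncard_coe_finset]
  refine Set.ncard_le_ncard (fun w hw => ?_) (Set.toFinite _)
  simp only [Finset.mem_coe, List.mem_toFinset] at hw
  exact ⟨p.takeUntil w hw⟩

lemma ncard_edgeSet_le [Finite V] {d : ℕ} (hd : ∀ v, (G.neighborSet v).ncard ≤ d) :
    G.edgeSet.ncard ≤ Nat.card V * d := by
  classical
  have := Fintype.ofFinite V
  have h := G.sum_degrees_eq_twice_card_edges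
  have h' : ∑ v, G.degree v ≤ Fintype.card V * d := by
    refine Finset.sum_le_card_nsmul _ _ _ fun v _ => ?_
    rw [← card_neighborSet_eq_degree, ← Nat.card_eq_fintype_card]
    exact hd v
  rw [← coe_edgeFinset, Set.ncard_coe_finset, Nat.card_eq_fintype_card]
  omega

lemma ncard_neighborSet_induce_le [Finite V] (W : Set V) (w : W) :
    ((G.induce W).neighborSet w).ncard ≤ (G.neighborSet w).ncard := by
  rw [← Set.ncard_image_of_injective _ Subtype.val_injective]
  refine Set.ncard_le_ncard ?_ (Set.toFinite _)
  rintro _ ⟨x, hx, rfl⟩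
  exact hx

/-- The graph on the vertices in `Q` in which two vertices are adjacent if they are at distance at
most `m` in `G`. -/
def proximity (Q : Finset V) (m : ℕ) : SimpleGraph V where
  Adj u v := u ≠ v ∧ u ∈ Q ∧ v ∈ Q ∧ G.edist u v ≤ m
  symm := ⟨fun _ _ h => ⟨h.1.symm, h.2.2.1, h.2.1, by rw [edist_comm]; exact h.2.2.2⟩⟩
  loopless := ⟨fun _ h => h.1 rfl⟩

variable {G}

lemma edist_le_of_proximity {Q : Finset V} {m : ℕ} {u v : V} {k : ℕ}
    (h : (G.proximity Q m).edist u v ≤ k) : G.edist u v ≤ (k * m : ℕ) := by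
  induction k generalizing v with
  | zero =>
    have : u = v := by simpa using h
    simp [this]
  | succ k ih =>
    obtain ⟨w, hw, h | h⟩ := (edist_le_add_one_iff _).1 h
    · subst h
      exact (ih hw).trans (by exact_mod_cast Nat.mul_le_mul_right m (Nat.le_succ k))
    · calc G.edist u v ≤ G.edist u w + G.edist w v := SimpleGraph.edist_triangle
        _ ≤ (k * m : ℕ) + m := add_le_add (ih hw) h.2.2.2
        _ = ((k + 1) * m : ℕ) := by push_cast; ring

lemma mem_of_reachable_proximity {Q : Finset V} {m : ℕ} {u v : V} (hu : u ∈ Q)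
    (h : (G.proximity Q m).Reachable u v) : v ∈ Q := by
  obtain ⟨p⟩ := h
  induction p with
  | nil => exact hu
  | cons h _ ih => exact ih h.2.2.1

end SimpleGraph

/-! ### Union bounds over separated sets -/

namespace LLLInstance

variable {S : Type u} [MeasurableSpace S] {I : LLLInstance.{u, v, w} S}

/-- In the proximity graph on `Q`, some component is large. -/
def HasLargeComponent (m s : ℕ) (Q : Finset I.Event) : Prop :=
  ∃ e ∈ Q, s ≤ {f | (I.graph.proximity Q m).Reachable e f}.ncard

/-- The breadth-first layers of a large component. -/
lemma HasLargeComponent.exists_layers {m s : ℕ} {Q : Finset I.Event}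
    (hQ : HasLargeComponent m s Q) :
    ∃ (e : I.Event) (F : Fin (Nat.card I.Event) → Finset I.Event),
      IsLayered (fun a b => I.graph.edist a b ≤ m) (Nat.card I.Event) {e} F ∧
      (∀ j, F j ⊆ Q) ∧ (∀ i j, i ≠ j → Disjoint (F i) (F j)) ∧ s ≤ ∑ j, (F j).card := by
  classical
  obtain ⟨e, he, hs⟩ := hQ
  set H := I.graph.proximity Q m with hH
  set G : ℕ → Finset I.Event := fun j => Finset.univ.filter fun f => H.edist e f = j with hG
  have hmem : ∀ j f, f ∈ G j ↔ H.edist e f = j := by simp [hG]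
  have hreach : ∀ j f, f ∈ G j → H.Reachable e f := fun j f hf =>
    SimpleGraph.reachable_of_edist_ne_top (by rw [(hmem j f).1 hf]; exact ENat.natCast_ne_top j)
  have hcard : ∀ f, H.Reachable e f → ∃ j < Nat.card I.Event, H.edist e f = j := by
    intro f hf
    have hlt := hf.edist_lt_ncard
    obtain ⟨j, hj⟩ := ENat.ne_top_iff_exists.1 hlt.ne_top
    rw [← hj, Nat.cast_lt] at hlt
    refine ⟨j, hlt.trans_le ?_, hj.symm⟩
    rw [← Set.ncard_univ]
    exact Set.ncard_le_ncard (Set.subset_univ _) (Set.toFinite _)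
  have hlay := isLayered_of_forall (N := fun a b => I.graph.edist a b ≤ m)
    (fun j => Nat.casesOn j {e} G) (fun j f hf => ?_) (Nat.card I.Event) 0
  · refine ⟨e, fun j => G j, ?_, fun j f hf => ?_, fun i j hij => ?_, ?_⟩
    · have h0 : ∀ j : Fin (Nat.card I.Event), 0 + 1 + (j : ℕ) = j + 1 := fun j => by omega
      simp only [h0] at hlay
      exact hlay
    · exact SimpleGraph.mem_of_reachable_proximity he (hreach j f hf)
    · refine Finset.disjoint_left.2 fun f hi hj => hij (Fin.ext ?_)
      rw [hmem] at hi hj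
      exact_mod_cast hi.symm.trans hj
    · refine hs.trans ?_
      rw [← Finset.card_biUnion, ← Set.ncard_coe_finset]
      · refine Set.ncard_le_ncard (fun f hf => ?_) (Set.toFinite _)
        obtain ⟨j, hj, hjf⟩ := hcard f hf
        simp only [Finset.coe_biUnion, Set.mem_iUnion, Finset.mem_coe]
        exact ⟨⟨j, hj⟩, Finset.mem_univ _, (hmem j f).2 hjf⟩
      · intro i _ j _ hij
        refine Finset.disjoint_left.2 fun f hi hj => hij (Fin.ext ?_)
        rw [hmem] at hi hj
        exact_mod_cast hi.symm.trans hj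
  · cases j with
    | zero =>
      have : e = f := by simpa [hmem] using hf
      exact ⟨e, Finset.mem_singleton_self e, by simp [this]⟩
    | succ j =>
      have hf' : H.edist e f = (j + 1 : ℕ) := (hmem _ _).1 hf
      obtain ⟨g, hg, hgf⟩ := (SimpleGraph.edist_le_add_one_iff _).1 hf'.le
      -- If the penultimate vertex were closer to `e` than `j`, then `f` would be closer than `j +
      -- 1`.
      have hgj : H.edist e g = j := by
        refine le_antisymm hg ?_
        rcases j.eq_zero_or_pos with rfl | hj
        · simp
        · obtain ⟨i, hi⟩ := ENat.ne_top_iff_exists.1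
            (ne_top_of_le_ne_top (ENat.natCast_ne_top j) hg)
          rw [← hi, Nat.cast_le] at hg ⊢
          by_contra! hij
          have h2 : H.edist e f ≤ (i + 1 : ℕ) :=
            (H.edist_le_add_one_iff).2 ⟨g, hi.ge, hgf⟩
          rw [hf', Nat.cast_le] at h2
          omega
      refine ⟨g, (hmem j g).2 hgj, ?_⟩
      rcases hgf with rfl | hgf
      · simp
      · exact hgf.2.2.2

/-- Breadth-first layers turn a large component into a layered sequence starting from one of `n`
events. The layers are disjoint and their union is separated, so a sequence of total size `m` has
probability at most `q ^ m`, to be set against at most `(d + 1) ^ m'` successors per member, where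
`m'` is the proximity distance. -/
theorem tableLaw_hasLargeComponent_le {d m s R : ℕ} {q : ℝ} (hq0 : 0 ≤ q)
    {A : I.Table → I.Event → Prop}
    (hd : ∀ e, (I.graph.neighborSet e).ncard ≤ d)
    (hA : ∀ Q : Finset I.Event, IsSeparated R Q →
      I.tableLaw {ω | ∀ e ∈ Q, A ω e} ≤ ENNReal.ofReal q ^ Q.card)
    (hrate : 3 * ((d : ℝ) + 1) ^ m * q ≤ 1) :
    I.tableLaw {ω | ∃ Q : Finset I.Event, (∀ e ∈ Q, A ω e) ∧ IsSeparated R Q ∧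
      HasLargeComponent m s Q} ≤
      ENNReal.ofReal (Nat.card I.Event * (3 * (3 * ((d : ℝ) + 1) ^ m * q) ^ s)) := by
  classical
  set n := Nat.card I.Event with hn
  set B : ℝ := 3 * ((d : ℝ) + 1) ^ m with hB
  have hB0 : 0 < B := by positivity
  set T : I.Event → Finset (Fin n → Finset I.Event) := fun e => Finset.univ.filter fun F =>
    IsLayered (fun a b => I.graph.edist a b ≤ m) n {e} F ∧
      IsSeparated R (Finset.univ.biUnion F) ∧ (∀ i j, i ≠ j → Disjoint (F i) (F j)) ∧
      s ≤ ∑ j, (F j).card with hT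
  have hsub : {ω | ∃ Q : Finset I.Event, (∀ e ∈ Q, A ω e) ∧ IsSeparated R Q ∧
      HasLargeComponent m s Q} ⊆
      ⋃ e ∈ Finset.univ, ⋃ F ∈ T e, {ω | ∀ f ∈ Finset.univ.biUnion F, A ω f} := by
    rintro ω ⟨Q, hQA, hQs, hQl⟩
    obtain ⟨e, F, hF, hFQ, hdisj, hs⟩ := hQl.exists_layers
    have hsubQ : Finset.univ.biUnion F ⊆ Q := Finset.biUnion_subset.2 fun j _ => hFQ j
    simp only [Set.mem_iUnion]
    exact ⟨e, Finset.mem_univ e, F, Finset.mem_filter.2 ⟨Finset.mem_univ _, hF,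
      fun a ha b hb => hQs a (hsubQ ha) b (hsubQ hb), hdisj, hs⟩, fun f hf => hQA f (hsubQ hf)⟩
  have hterm : ∀ e, ∑ F ∈ T e, I.tableLaw {ω | ∀ f ∈ Finset.univ.biUnion F, A ω f} ≤
      ENNReal.ofReal (3 * (B * q) ^ s) := by
    intro e
    calc _ ≤ ∑ F ∈ T e, ENNReal.ofReal ((1 / B) ^ (∑ j, (F j).card) * (B * q) ^ s) := by
          refine Finset.sum_le_sum fun F hF => ?_
          obtain ⟨-, hsep, hdisj, hs⟩ := (Finset.mem_filter.1 hF).2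
          refine (hA _ hsep).trans ?_
          rw [← ENNReal.ofReal_pow hq0, Finset.card_biUnion fun i _ j _ hij => hdisj i j hij]
          refine ENNReal.ofReal_le_ofReal ?_
          calc q ^ (∑ j, (F j).card) = (1 / B) ^ (∑ j, (F j).card) *
                (B * q) ^ (∑ j, (F j).card) := by
                rw [← mul_pow]; congr 1; field_simp
            _ ≤ (1 / B) ^ (∑ j, (F j).card) * (B * q) ^ s := by
                gcongr ?_ * ?_
                exact pow_le_pow_of_le_one (by positivity) hrate hs
      _ = ENNReal.ofReal (∑ F ∈ T e, (1 / B) ^ (∑ j, (F j).card) * (B * q) ^ s) :=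
        (ENNReal.ofReal_sum_of_nonneg fun _ _ => by positivity).symm
      _ ≤ ENNReal.ofReal (3 * (B * q) ^ s) := by
        refine ENNReal.ofReal_le_ofReal ?_
        rw [← Finset.sum_mul]
        refine mul_le_mul_of_nonneg_right ?_ (by positivity)
        have := sum_isLayered_le (N := fun a b => I.graph.edist a b ≤ m) (D := (d + 1) ^ m)
          (Nat.one_le_pow _ _ (by omega)) (fun a => by
            have h := I.graph.ncard_edist_le hd a m
            rw [Set.ncard_eq_toFinset_card'] at h
            convert h using 2
            ext f
            simp) n {e}
        push_cast at this
        rw [Finset.card_singleton, pow_one] at this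
        refine le_trans (Finset.sum_le_sum_of_subset_of_nonneg ?_ fun _ _ _ => by positivity) this
        exact Finset.monotone_filter_right _ fun F _ hF => hF.1
  calc _ ≤ I.tableLaw (⋃ e ∈ Finset.univ, ⋃ F ∈ T e,
        {ω | ∀ f ∈ Finset.univ.biUnion F, A ω f}) := measure_mono hsub
    _ ≤ ∑ e, I.tableLaw (⋃ F ∈ T e, {ω | ∀ f ∈ Finset.univ.biUnion F, A ω f}) :=
        measure_biUnion_finset_le _ _
    _ ≤ ∑ e : I.Event, ENNReal.ofReal (3 * (B * q) ^ s) :=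
        Finset.sum_le_sum fun e _ => (measure_biUnion_finset_le _ _).trans (hterm e)
    _ = ENNReal.ofReal (n * (3 * (B * q) ^ s)) := by
        rw [Finset.sum_const, nsmul_eq_mul, ENNReal.ofReal_mul (Nat.cast_nonneg _),
          ENNReal.ofReal_natCast, hn, Nat.card_eq_fintype_card, Finset.card_univ]

/-- Union bound over the `s`-element sets, with `n.choose s ≤ n ^ s / s!` and `s ^ s / s! ≤ 3 ^ s`.
-/
theorem tableLaw_exists_separated_le {s R : ℕ} {q : ℝ} (hq0 : 0 ≤ q)
    {A : I.Table → I.Event → Prop}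
    (hA : ∀ Q : Finset I.Event, IsSeparated R Q →
      I.tableLaw {ω | ∀ e ∈ Q, A ω e} ≤ ENNReal.ofReal q ^ Q.card) (hs : 1 ≤ s) :
    I.tableLaw {ω | ∃ Q : Finset I.Event, (∀ e ∈ Q, A ω e) ∧ IsSeparated R Q ∧ s ≤ Q.card} ≤
      ENNReal.ofReal ((3 * Nat.card I.Event * q / s) ^ s) := by
  classical
  set T : Finset (Finset I.Event) :=
    (Finset.powersetCard s Finset.univ).filter fun Q => IsSeparated R Q with hT
  have hsub : {ω | ∃ Q : Finset I.Event, (∀ e ∈ Q, A ω e) ∧ IsSeparated R Q ∧ s ≤ Q.card} ⊆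
      ⋃ Q ∈ T, {ω | ∀ e ∈ Q, A ω e} := by
    rintro ω ⟨Q, hQA, hQs, hQc⟩
    obtain ⟨Q', hQ', hc⟩ := Finset.exists_subset_card_eq hQc
    simp only [Set.mem_iUnion]
    exact ⟨Q', Finset.mem_filter.2 ⟨Finset.mem_powersetCard.2 ⟨Finset.subset_univ _, hc⟩,
      fun a ha b hb => hQs a (hQ' ha) b (hQ' hb)⟩, fun f hf => hQA f (hQ' hf)⟩
  set n := Nat.card I.Event with hn
  have hs0 : (0 : ℝ) < s := by exact_mod_cast hs
  calc _ ≤ ∑ Q ∈ T, I.tableLaw {ω | ∀ e ∈ Q, A ω e} :=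
        (measure_mono hsub).trans (measure_biUnion_finset_le _ _)
    _ ≤ ∑ Q ∈ T, ENNReal.ofReal (q ^ s) := by
        refine Finset.sum_le_sum fun Q hQ => ?_
        obtain ⟨h1, h2⟩ := Finset.mem_filter.1 hQ
        rw [ENNReal.ofReal_pow hq0, ← (Finset.mem_powersetCard.1 h1).2]
        exact hA Q h2
    _ = ENNReal.ofReal (T.card * q ^ s) := by
        rw [Finset.sum_const, nsmul_eq_mul, ENNReal.ofReal_mul (by positivity),
          ENNReal.ofReal_natCast]
    _ ≤ ENNReal.ofReal ((3 * n * q / s) ^ s) := by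
        refine ENNReal.ofReal_le_ofReal ?_
        have hTn : (T.card : ℝ) ≤ n.choose s := by
          have : T.card ≤ n.choose s := by
            refine (Finset.card_filter_le _ _).trans ?_
            rw [Finset.card_powersetCard, Finset.card_univ, hn, Nat.card_eq_fintype_card]
          exact_mod_cast this
        have hexp : (s : ℝ) ^ s / s.factorial ≤ 3 ^ s := by
          refine (Real.pow_div_factorial_le_exp (s : ℝ) hs0.le s).trans ?_
          rw [← mul_one (s : ℝ), Real.exp_nat_mul]
          refine pow_le_pow_left₀ (Real.exp_pos _).le ?_ _
          have := Real.exp_one_lt_d9; linarith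
        have hfac : (0 : ℝ) < s.factorial := by exact_mod_cast Nat.factorial_pos s
        calc (T.card : ℝ) * q ^ s ≤ (n ^ s / s.factorial) * q ^ s := by
              gcongr
              exact hTn.trans (Nat.choose_le_pow_div s n)
          _ = (n * q / s) ^ s * (s ^ s / s.factorial) := by
              rw [div_pow, mul_pow]; field_simp
          _ ≤ (n * q / s) ^ s * 3 ^ s := by gcongr
          _ = (3 * n * q / s) ^ s := by rw [← mul_pow]; congr 1; ring

end LLLInstance

/-! ### From a maximal separated set to all insecure events -/

namespace LLLInstance

variable {S : Type u} [MeasurableSpace S] {I : LLLInstance.{u, v, w} S}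

/-- Every set of events contains a maximal separated subset. -/
lemma exists_maximal_separated (R : ℕ) (W : Set I.Event) :
    ∃ Q : Finset I.Event, (∀ e ∈ Q, e ∈ W) ∧ IsSeparated R Q ∧
      ∃ a : I.Event → I.Event, ∀ e ∈ W, a e ∈ Q ∧ I.graph.edist e (a e) ≤ (2 * R + 1 : ℕ) := by
  classical
  set T : Finset (Finset I.Event) := Finset.univ.filter fun Q => (∀ e ∈ Q, e ∈ W) ∧ IsSeparated R Q
  obtain ⟨Q, hQ, hmax⟩ := T.exists_max_image Finset.card
    ⟨∅, Finset.mem_filter.2 ⟨Finset.mem_univ _, by simp, by simp [IsSeparated]⟩⟩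
  obtain ⟨hQW, hQs⟩ := (Finset.mem_filter.1 hQ).2
  refine ⟨Q, hQW, hQs, ?_⟩
  -- An event of `W` far from all of `Q` could be added to `Q`, contradicting the maximal
  -- cardinality.
  have H : ∀ e, ∃ f, e ∈ W → f ∈ Q ∧ I.graph.edist e f ≤ (2 * R + 1 : ℕ) := by
    intro e
    by_contra! hcon
    have heW := (hcon e).1
    have hfar : ∀ f ∈ Q, ¬ I.graph.edist e f ≤ (2 * R + 1 : ℕ) := fun f hf =>
      not_le.2 ((hcon f).2 hf)
    have heQ : e ∉ Q := fun h => hfar e h (by simp)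
    have hins : insert e Q ∈ T := by
      refine Finset.mem_filter.2 ⟨Finset.mem_univ _, ?_, ?_⟩
      · intro f hf
        rcases Finset.mem_insert.1 hf with rfl | hf
        · exact heW
        · exact hQW f hf
      · intro f hf g hg hne
        rcases Finset.mem_insert.1 hf with rfl | hf' <;>
          rcases Finset.mem_insert.1 hg with rfl | hg'
        · exact absurd rfl hne
        · exact hfar g hg'
        · rw [SimpleGraph.edist_comm]; exact hfar f hf'
        · exact hQs f hf' g hg' hne
    have := hmax _ hins
    rw [Finset.card_insert_of_notMem heQ] at this
    omega
  choose a ha using H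
  exact ⟨a, ha⟩

variable {R : ℕ} {W : Set I.Event} {Q : Finset I.Event} {a : I.Event → I.Event}

lemma ncard_le_of_near_separated {d : ℕ} (hd : ∀ e, (I.graph.neighborSet e).ncard ≤ d)
    (ha : ∀ e ∈ W, a e ∈ Q ∧ I.graph.edist e (a e) ≤ (2 * R + 1 : ℕ)) (V : Set I.Event)
    (hVW : V ⊆ W) (P : Set I.Event) (hP : ∀ e ∈ V, a e ∈ P) :
    V.ncard ≤ P.ncard * (d + 1) ^ (2 * R + 1) := by
  classical
  have hsub : V.toFinset ⊆ P.toFinset.biUnion fun q =>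
      {f | I.graph.edist q f ≤ (2 * R + 1 : ℕ)}.toFinset := by
    intro e he
    rw [Set.mem_toFinset] at he
    simp only [Finset.mem_biUnion, Set.mem_toFinset, Set.mem_ofPred_eq]
    exact ⟨a e, hP e he, by rw [SimpleGraph.edist_comm]; exact (ha e (hVW he)).2⟩
  rw [Set.ncard_eq_toFinset_card', Set.ncard_eq_toFinset_card']
  refine (Finset.card_le_card hsub).trans (Finset.card_biUnion_le_card_mul _ _ _ fun q _ => ?_)
  rw [← Set.ncard_eq_toFinset_card']
  exact I.graph.ncard_edist_le hd q _

/-- Two detours of length at most `2 * R + 1` and one edge: hence the threshold `4 * R + 3`. -/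
lemma eq_or_proximity_adj (ha : ∀ e ∈ W, a e ∈ Q ∧ I.graph.edist e (a e) ≤ (2 * R + 1 : ℕ))
    {e f : I.Event} (he : e ∈ W) (hf : f ∈ W) (hef : I.graph.Adj e f) :
    a e = a f ∨ (I.graph.proximity Q (4 * R + 3)).Adj (a e) (a f) := by
  by_cases h : a e = a f
  · exact Or.inl h
  · refine Or.inr ⟨h, (ha e he).1, (ha f hf).1, ?_⟩
    calc I.graph.edist (a e) (a f)
        ≤ I.graph.edist (a e) e + I.graph.edist e (a f) := SimpleGraph.edist_triangle
      _ ≤ I.graph.edist (a e) e + (I.graph.edist e f + I.graph.edist f (a f)) := by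
        gcongr; exact SimpleGraph.edist_triangle
      _ ≤ (2 * R + 1 : ℕ) + (1 + (2 * R + 1 : ℕ)) := by
        gcongr
        · rw [SimpleGraph.edist_comm]; exact (ha e he).2
        · exact (SimpleGraph.edist_eq_one_iff_adj.2 hef).le
        · exact (ha f hf).2
      _ = (4 * R + 3 : ℕ) := by
        push_cast; ring

lemma edist_le_of_edist_proximity
    (ha : ∀ e ∈ W, a e ∈ Q ∧ I.graph.edist e (a e) ≤ (2 * R + 1 : ℕ))
    {e f : I.Event} (he : e ∈ W) (hf : f ∈ W) {k : ℕ}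
    (h : (I.graph.proximity Q (4 * R + 3)).edist (a e) (a f) ≤ k) :
    I.graph.edist e f ≤ (k * (4 * R + 3) + 2 * (2 * R + 1) : ℕ) := by
  calc I.graph.edist e f
      ≤ I.graph.edist e (a e) + I.graph.edist (a e) f := SimpleGraph.edist_triangle
    _ ≤ I.graph.edist e (a e) + (I.graph.edist (a e) (a f) + I.graph.edist (a f) f) := by
      gcongr; exact SimpleGraph.edist_triangle
    _ ≤ (2 * R + 1 : ℕ) + ((k * (4 * R + 3) : ℕ) + (2 * R + 1 : ℕ)) := by
      gcongr
      · exact (ha e he).2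
      · exact SimpleGraph.edist_le_of_proximity h
      · rw [SimpleGraph.edist_comm]; exact (ha f hf).2
    _ = (k * (4 * R + 3) + 2 * (2 * R + 1) : ℕ) := by
      rw [← Nat.cast_add, ← Nat.cast_add]; congr 1; ring

lemma reachable_proximity (ha : ∀ e ∈ W, a e ∈ Q ∧ I.graph.edist e (a e) ≤ (2 * R + 1 : ℕ))
    {e f : W} (h : (I.graph.induce W).Reachable e f) :
    (I.graph.proximity Q (4 * R + 3)).Reachable (a e.1) (a f.1) := by
  obtain ⟨p⟩ := h
  induction p with
  | nil => exact SimpleGraph.Reachable.refl _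
  | @cons x y z hxy _ ih =>
    refine SimpleGraph.Reachable.trans ?_ ih
    rcases eq_or_proximity_adj ha x.2 y.2 hxy with h | h
    · rw [h]
    · exact h.reachable

/-- The map `a` sends a component into a single component of the proximity graph, with at most `s`
members. Each fibre of `a` lies in a ball of radius `2 * R + 1`. -/
theorem component_bounds {d s : ℕ} (hd : ∀ e, (I.graph.neighborSet e).ncard ≤ d)
    (ha : ∀ e ∈ W, a e ∈ Q ∧ I.graph.edist e (a e) ≤ (2 * R + 1 : ℕ))
    (hs : ¬ HasLargeComponent (4 * R + 3) s Q) (K : (I.graph.induce W).ConnectedComponent) :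
    K.supp.ncard ≤ s * (d + 1) ^ (2 * R + 1) ∧ ∀ e ∈ K.supp, ∀ f ∈ K.supp,
      I.graph.edist e.1 f.1 ≤ (s * (4 * R + 3) + 2 * (2 * R + 1) : ℕ) := by
  have hsmall : ∀ q ∈ Q, {f | (I.graph.proximity Q (4 * R + 3)).Reachable q f}.ncard ≤ s :=
    fun q hq => not_lt.1 fun h => hs ⟨q, hq, h.le⟩
  have hreach : ∀ e ∈ K.supp, ∀ f ∈ K.supp, (I.graph.induce W).Reachable e f := by
    intro e he f hf
    rw [SimpleGraph.ConnectedComponent.mem_supp_iff] at he hf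
    exact SimpleGraph.ConnectedComponent.exact (he.trans hf.symm)
  constructor
  · obtain ⟨e, he⟩ := K.nonempty_supp
    have h := ncard_le_of_near_separated hd ha (Subtype.val '' K.supp)
      (by rintro _ ⟨x, -, rfl⟩; exact x.2)
      {f | (I.graph.proximity Q (4 * R + 3)).Reachable (a e.1) f} (by
        rintro _ ⟨x, hx, rfl⟩
        exact reachable_proximity ha (hreach e he x hx))
    rw [Set.ncard_image_of_injective _ Subtype.val_injective] at h
    exact h.trans (Nat.mul_le_mul_right _ (hsmall _ (ha e.1 e.2).1))
  · intro e he f hf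
    refine edist_le_of_edist_proximity ha e.2 f.2 ?_
    exact (reachable_proximity ha (hreach e he f hf)).edist_lt_ncard.le.trans
      (by exact_mod_cast hsmall _ (ha e.1 e.2).1)

theorem hasNetworkDecomposition_of_separated {s k k' D : ℕ}
    (ha : ∀ e ∈ W, a e ∈ Q ∧ I.graph.edist e (a e) ≤ (2 * R + 1 : ℕ))
    (hs : ¬ HasLargeComponent (4 * R + 3) s Q) (hsk : s < 2 ^ k) (hk1 : 1 ≤ k) (hk : k ≤ k')
    (hD : 2 * k * (4 * R + 3) + 2 * (2 * R + 1) ≤ D) :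
    HasNetworkDecomposition I.graph W k' D := by
  classical
  obtain ⟨cl, col, hcol, hcc, hdiam, hadj⟩ :=
    (I.graph.proximity Q (4 * R + 3)).exists_decomposition k (by
      intro K
      obtain ⟨q, hq⟩ := K.nonempty_supp
      have hK : K.supp = {f | (I.graph.proximity Q (4 * R + 3)).Reachable q f} := by
        rw [SimpleGraph.ConnectedComponent.mem_supp_iff] at hq
        ext f
        rw [SimpleGraph.ConnectedComponent.mem_supp_iff, ← hq, SimpleGraph.ConnectedComponent.eq]
        exact ⟨SimpleGraph.Reachable.symm, SimpleGraph.Reachable.symm⟩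
      by_cases hqQ : q ∈ Q
      · rw [hK]
        exact (not_le.1 fun h => hs ⟨q, hqQ, h⟩).trans hsk
      -- Events outside `Q` are isolated in the proximity graph; `1 ≤ k` makes room for such
      -- singletons.
      · have : K.supp ⊆ {q} := by
          rw [hK]
          rintro f ⟨p⟩
          cases p with
          | nil => rfl
          | cons h _ => exact absurd h.2.1 hqQ
        calc K.supp.ncard ≤ ({q} : Set I.Event).ncard := Set.ncard_le_ncard this (Set.toFinite _)
          _ = 1 := Set.ncard_singleton q
          _ < 2 ^ k := Nat.one_lt_two_pow (by omega))
  rcases isEmpty_or_nonempty W with hW | ⟨⟨w₀⟩⟩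
  · exact ⟨id, fun w => (hW.false w).elim, fun w => (hW.false w).elim, fun w => (hW.false w).elim⟩
  -- Clusters must be labelled by elements of `W`, while the label `cl (a w)` need not lie in `W`;
  -- so each label is replaced by a member of its own cluster.
  obtain ⟨rep, hrep⟩ : ∃ rep : I.Event → W, ∀ w : W, cl (a (rep (cl (a w.1))).1) = cl (a w.1) := by
    refine ⟨fun c => if h : ∃ w : W, cl (a w.1) = c then h.choose else w₀, fun w => ?_⟩
    have h : ∃ w' : W, cl (a w'.1) = cl (a w.1) := ⟨w, rfl⟩
    simp only [h, dif_pos]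
    exact h.choose_spec
  refine ⟨fun w => rep (cl (a w.1)), fun w => ⟨col (a w.1), (hcol _).trans_le hk⟩, ?_, ?_⟩
  · intro x y hxy
    have h : cl (a x.1) = cl (a y.1) := by
      rw [← hrep x, ← hrep y]
      exact congrArg (fun z : W => cl (a z.1)) hxy
    exact (edist_le_of_edist_proximity ha x.2 y.2 (hdiam _ _ h)).trans (by exact_mod_cast hD)
  · intro x y hxy hne
    have h : cl (a x.1) ≠ cl (a y.1) := fun h => hne (congrArg rep h)
    have hcolrep : ∀ z : W, col (a (rep (cl (a z.1))).1) = col (a z.1) := fun z => by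
      rw [← hcc, hrep, hcc]
    have hxy' := (eq_or_proximity_adj ha x.2 y.2 hxy).resolve_left fun h' => h (by rw [h'])
    simp only [ne_eq, Fin.mk.injEq, hcolrep]
    exact hadj _ _ hxy' h

end LLLInstance

/-! ### The probabilistic statements from numerical conditions -/

namespace LLLInstance

/-- Numerical conditions under which the insecure events with parameters `K`, `J`, `M + 1` and `ε`
have all the required properties. -/
structure Admissible (c C κ ε p : ℝ) (n d K J M s s' k : ℕ) : Prop where
  one_le_d : 1 ≤ d
  one_le_K : 1 ≤ K
  one_le_s' : 1 ≤ s'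
  one_le_k : 1 ≤ k
  eps_nonneg : 0 ≤ ε
  lt_pow : (M : ℝ) < (1 + ε) ^ J
  rate_le : witnessRate d p ε ≤ 1
  witness_le : n * (3 * witnessRate d p ε ^ (M + 1)) ≤ (n : ℝ) ^ (-c)
  component_rate_le : 3 * ((d : ℝ) + 1) ^ (4 * (2 * K + 2 * J + 2) + 3) *
    ((J + 1) * (3 * witnessRate d p ε ^ K)) ≤ 1
  component_le : n * (3 * (3 * ((d : ℝ) + 1) ^ (4 * (2 * K + 2 * J + 2) + 3) *
    ((J + 1) * (3 * witnessRate d p ε ^ K))) ^ s) ≤ (n : ℝ) ^ (-c)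
  separated_le : (3 * n * ((J + 1) * (3 * witnessRate d p ε ^ K)) / s') ^ s' ≤ (n : ℝ) ^ (-c)
  number_le : (s' * (d + 1) ^ (2 * (2 * K + 2 * J + 2) + 1) * d : ℝ) ≤
    n * p ^ (κ * Real.log (Real.logb (1 / p) n))
  radius_le : 2 * K + 2 * J + 3 ≤ ⌊C * Real.log (Real.logb (1 / p) n)⌋₊
  size_le : (s * (d + 1) ^ (2 * (2 * K + 2 * J + 2) + 1) : ℝ) ≤
    (d : ℝ) ^ (C * Real.log (Real.logb (1 / p) n))
  diam_le : s * (4 * (2 * K + 2 * J + 2) + 3) + 2 * (2 * (2 * K + 2 * J + 2) + 1) ≤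
    ⌊C * Real.logb (1 / p) n⌋₊
  s_lt : s < 2 ^ k
  k_le : k ≤ ⌊C * Real.log (Real.logb (1 / p) n)⌋₊
  cluster_le : 2 * k * (4 * (2 * K + 2 * J + 2) + 3) + 2 * (2 * (2 * K + 2 * J + 2) + 1) ≤
    ⌊C * Real.log (Real.logb (1 / p) n) ^ 2⌋₊

variable {S : Type u} [MeasurableSpace S] {I : LLLInstance.{u, v, w} S}
  {c C κ ε p : ℝ} {n d K J M s s' k : ℕ}

lemma Whp.of_tableLaw_le (hI : I.HasParams n d p) {P B : I.Table → Prop} {b : ℝ}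
    (hPB : ∀ ω, ¬ B ω → P ω) (hB : I.tableLaw {ω | B ω} ≤ ENNReal.ofReal b)
    (hb : b ≤ (n : ℝ) ^ (-c)) : I.Whp c P := by
  unfold Whp
  rw [hI.card_event]
  refine (measure_mono fun ω hω => ?_).trans (hB.trans (ENNReal.ofReal_le_ofReal hb))
  by_contra h
  exact hω (hPB ω h)

variable (hA : Admissible c C κ ε p n d K J M s s' k) (hp : 0 < p) (hI : I.HasParams n d p)

include hA hp hI

lemma Admissible.tableLaw_not_noLargeWitness_le :
    I.tableLaw {ω | ¬ NoLargeWitness M ω} ≤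
      ENNReal.ofReal (n * (3 * witnessRate d p ε ^ (M + 1))) := by
  have hsub : {ω : I.Table | ¬ NoLargeWitness M ω} ⊆ ⋃ e ∈ (Finset.univ : Finset I.Event),
      {ω | ∃ F : Fin (M + 1) → Finset I.Event, IsWitness ω Set.univ Set.univ e F ∧
        M + 1 ≤ checkedCard F Set.univ ∧
          (layersCard F : ℝ) ≤ (1 + ε) * checkedCard F Set.univ} := by
    intro ω hω
    simp only [Set.mem_ofPred_eq, NoLargeWitness, not_forall, not_le] at hω
    obtain ⟨e, F, hF, hM⟩ := hω
    simp only [Set.mem_iUnion]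
    refine ⟨e, Finset.mem_univ e, F, hF, hM, ?_⟩
    have : layersCard F = checkedCard F Set.univ := by simp [layersCard, checkedCard]
    rw [this]
    nlinarith [hA.eps_nonneg, (Nat.cast_nonneg (checkedCard F Set.univ) : (0 : ℝ) ≤ _)]
  calc _ ≤ ∑ _e : I.Event, ENNReal.ofReal (3 * witnessRate d p ε ^ (M + 1)) :=
        ((measure_mono hsub).trans (measure_biUnion_finset_le _ _)).trans
          (Finset.sum_le_sum fun e _ => tableLaw_exists_witness_le hp.le hI.degree_le hI.prob_le
            hA.rate_le _ _ e _ _)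
    _ = _ := by
      rw [Finset.sum_const, nsmul_eq_mul, ENNReal.ofReal_mul (Nat.cast_nonneg n),
        ENNReal.ofReal_natCast, ← hI.card_event, Nat.card_eq_fintype_card, Finset.card_univ]

lemma Admissible.whp_fixedAfter : I.Whp c (fun ω => ∀ e, ¬ Insecure K J (M + 1) ε I ω e →
    FixedAfter ω ⌊C * Real.log (Real.logb (1 / p) n)⌋₊ e) := by
  refine Whp.of_tableLaw_le hI (B := fun ω => ¬ NoLargeWitness M ω) (fun ω hω e he => ?_)
    (hA.tableLaw_not_noLargeWitness_le hp hI) hA.witness_le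
  exact ((not_not.1 hω).fixedAfter hA.eps_nonneg hA.one_le_K hA.lt_pow he).mono
    (by have := hA.radius_le; omega)

lemma Admissible.tableLaw_separated_le (Q : Finset I.Event)
    (hQ : IsSeparated (2 * K + 2 * J + 2) Q) :
    I.tableLaw {ω | ∀ e ∈ Q, Insecure K J (M + 1) ε I ω e} ≤
      ENNReal.ofReal ((J + 1) * (3 * witnessRate d p ε ^ K)) ^ Q.card :=
  tableLaw_forall_insecure_le
    (fun e => tableLaw_insecure_le hp.le hI.degree_le hI.prob_le hA.rate_le e K J (M + 1)) hQ

omit hA hI in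
lemma insecureBound_nonneg : 0 ≤ ((J : ℝ) + 1) * (3 * witnessRate d p ε ^ K) := by
  unfold witnessRate; positivity

/-- Fewer than `s'` separated insecure events dominate all the others, each through a ball of radius
`2 * R + 1`. The factor `d` in `number_le` covers the edges. -/
lemma Admissible.whp_card : I.Whp c (fun ω =>
    ({e | Insecure K J (M + 1) ε I ω e}.ncard : ℝ) ≤
      n * p ^ (κ * Real.log (Real.logb (1 / p) n)) ∧
    ((I.graph.induce {e | Insecure K J (M + 1) ε I ω e}).edgeSet.ncard : ℝ) ≤
      n * p ^ (κ * Real.log (Real.logb (1 / p) n))) := by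
  refine Whp.of_tableLaw_le hI (B := fun ω => ∃ Q : Finset I.Event,
      (∀ e ∈ Q, Insecure K J (M + 1) ε I ω e) ∧ IsSeparated (2 * K + 2 * J + 2) Q ∧ s' ≤ Q.card)
    (fun ω hω => ?_) (tableLaw_exists_separated_le (insecureBound_nonneg hp)
      (hA.tableLaw_separated_le hp hI) hA.one_le_s') (by rw [hI.card_event]; exact hA.separated_le)
  set W := {e | Insecure K J (M + 1) ε I ω e} with hW
  obtain ⟨Q, hQW, hQs, a, ha⟩ := exists_maximal_separated (2 * K + 2 * J + 2) W
  have hQ : Q.card < s' := not_le.1 fun h => hω ⟨Q, hQW, hQs, h⟩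
  have hWc : W.ncard ≤ s' * (d + 1) ^ (2 * (2 * K + 2 * J + 2) + 1) := by
    have := ncard_le_of_near_separated hI.degree_le ha W subset_rfl (Q : Set I.Event)
      fun e he => (ha e he).1
    rw [Set.ncard_coe_finset] at this
    exact this.trans (Nat.mul_le_mul_right _ hQ.le)
  have hE : (I.graph.induce W).edgeSet.ncard ≤ W.ncard * d :=
    (SimpleGraph.ncard_edgeSet_le _ fun w =>
      (I.graph.ncard_neighborSet_induce_le W w).trans (hI.degree_le w.1))
  have hWd : W.ncard * d ≤ s' * (d + 1) ^ (2 * (2 * K + 2 * J + 2) + 1) * d :=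
    Nat.mul_le_mul_right d hWc
  constructor
  · refine le_trans ?_ hA.number_le
    exact_mod_cast (Nat.le_mul_of_pos_right _ hA.one_le_d).trans hWd
  · refine le_trans ?_ hA.number_le
    exact_mod_cast hE.trans hWd

/-- The components of the proximity graph on separated insecure events are small. -/
lemma Admissible.tableLaw_largeComponent_le : I.tableLaw {ω | ∃ Q : Finset I.Event,
      (∀ e ∈ Q, Insecure K J (M + 1) ε I ω e) ∧ IsSeparated (2 * K + 2 * J + 2) Q ∧
      HasLargeComponent (4 * (2 * K + 2 * J + 2) + 3) s Q} ≤ ENNReal.ofReal (n *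
      (3 * (3 * ((d : ℝ) + 1) ^ (4 * (2 * K + 2 * J + 2) + 3) *
        ((J + 1) * (3 * witnessRate d p ε ^ K))) ^ s)) := by
  have := tableLaw_hasLargeComponent_le (s := s) (insecureBound_nonneg hp) hI.degree_le
    (hA.tableLaw_separated_le hp hI) hA.component_rate_le
  rwa [hI.card_event] at this

lemma Admissible.whp_component : I.Whp c (fun ω =>
    ∀ K' : (I.graph.induce {e | Insecure K J (M + 1) ε I ω e}).ConnectedComponent,
      (K'.supp.ncard : ℝ) ≤ (d : ℝ) ^ (C * Real.log (Real.logb (1 / p) n)) ∧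
      ∀ e ∈ K'.supp, ∀ f ∈ K'.supp,
        I.graph.edist e.1 f.1 ≤ (⌊C * Real.logb (1 / p) n⌋₊ : ℕ)) := by
  refine Whp.of_tableLaw_le hI (fun ω hω K' => ?_) (hA.tableLaw_largeComponent_le hp hI)
    hA.component_le
  obtain ⟨Q, hQW, hQs, a, ha⟩ := exists_maximal_separated (2 * K + 2 * J + 2)
    {e | Insecure K J (M + 1) ε I ω e}
  obtain ⟨h1, h2⟩ := component_bounds hI.degree_le ha (fun h => hω ⟨Q, hQW, hQs, h⟩) K'
  exact ⟨le_trans (by exact_mod_cast h1) hA.size_le,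
    fun e he f hf => (h2 e he f hf).trans (by exact_mod_cast hA.diam_le)⟩

lemma Admissible.whp_hasNetworkDecomposition : I.Whp c (fun ω =>
    HasNetworkDecomposition I.graph {e | Insecure K J (M + 1) ε I ω e}
      ⌊C * Real.log (Real.logb (1 / p) n)⌋₊ ⌊C * Real.log (Real.logb (1 / p) n) ^ 2⌋₊) := by
  refine Whp.of_tableLaw_le hI (fun ω hω => ?_) (hA.tableLaw_largeComponent_le hp hI)
    hA.component_le
  obtain ⟨Q, hQW, hQs, a, ha⟩ := exists_maximal_separated (2 * K + 2 * J + 2)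
    {e | Insecure K J (M + 1) ε I ω e}
  exact hasNetworkDecomposition_of_separated ha (fun h => hω ⟨Q, hQW, hQs, h⟩) hA.s_lt
    hA.one_le_k hA.k_le hA.cluster_le

end LLLInstance

/-! ### Estimates of the rates -/

namespace LLLInstance

open Filter Real

/-- The factor `8` will absorb `3 * (J + 1) ≤ 8 ^ K`; the second bound absorbs `3` and the passage
from `d + 1` to `2 * d` in a `K`-th power. -/
lemma exists_large_degree {δ : ℝ} (hδ : 0 < δ) : ∃ d₀ : ℝ, 3 ≤ d₀ ∧ ∀ d : ℝ, d₀ ≤ d →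
    8 * (3 * (d + 1) ^ 2) ^ (1 + min 1 (δ / 16)) ≤ d ^ (2 + δ / 4) ∧
    3 * (2 : ℝ) ^ (8 + δ / 8) ≤ d ^ (δ / 8) := by
  have h := tendsto_rpow_atTop (show 0 < δ / 8 by positivity)
  obtain ⟨d₀, hd₀⟩ := eventually_atTop.1 (((h.eventually_ge_atTop 1152).and
    (h.eventually_ge_atTop (3 * (2 : ℝ) ^ (8 + δ / 8)))).and (eventually_ge_atTop 3))
  refine ⟨d₀, (hd₀ d₀ le_rfl).2, fun d hd => ⟨?_, (hd₀ d hd).1.2⟩⟩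
  have h3 : 3 ≤ d := (hd₀ d hd).2
  set ε := min 1 (δ / 16)
  have hε1 : ε ≤ 1 := min_le_left _ _
  have hεδ : ε ≤ δ / 16 := min_le_right _ _
  have hε0 : 0 ≤ ε := by positivity
  calc 8 * (3 * (d + 1) ^ 2) ^ (1 + ε) ≤ 8 * (12 * d ^ 2) ^ (1 + ε) := by
        refine mul_le_mul_of_nonneg_left (rpow_le_rpow (by positivity) ?_ (by positivity))
          (by norm_num)
        nlinarith
    _ = 8 * ((12 : ℝ) ^ (1 + ε) * d ^ (2 * (1 + ε))) := by
        rw [mul_rpow (by norm_num) (by positivity), rpow_mul (by positivity)]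
        norm_num
    _ ≤ 8 * ((12 : ℝ) ^ (2 : ℝ) * d ^ (2 + δ / 8)) := by
        gcongr
        · norm_num
        · linarith
        · linarith
        · linarith
    _ = 1152 * d ^ (2 + δ / 8) := by norm_num; ring
    _ ≤ d ^ (δ / 8) * d ^ (2 + δ / 8) := by
        gcongr
        exact (hd₀ d hd).1.1
    _ = d ^ (2 + δ / 4) := by
        rw [← rpow_add (by linarith)]; congr 1; ring

/-- The exponent gained from the slack in the criterion `p ≤ d ^ (-(10 + δ))`. -/
noncomputable def slack (δ : ℝ) : ℝ := (δ / 2) / (10 + δ)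

lemma slack_pos {δ : ℝ} (hδ : 0 < δ) : 0 < slack δ := by unfold slack; positivity

lemma slack_le_one {δ : ℝ} (hδ : 0 < δ) : slack δ ≤ 1 := by
  unfold slack; rw [div_le_one (by positivity)]; linarith

/-- Only the part `p ^ (1 - slack δ)` is spent on the degrees, because `(10 + δ) * (1 - slack δ) =
10 + δ / 2`. -/
lemma mul_rpow_le_rpow_slack {δ p d : ℝ} (hδ : 0 < δ) (hp : 0 < p) (hd : 0 < d)
    (hpd : p ≤ d ^ (-(10 + δ))) : p * d ^ (10 + δ / 2) ≤ p ^ slack δ := by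
  have h1 : 0 ≤ 1 - slack δ := by linarith [slack_le_one hδ]
  have h2 : (10 + δ) * (1 - slack δ) = 10 + δ / 2 := by
    unfold slack; field_simp; ring
  calc p * d ^ (10 + δ / 2) = p ^ slack δ * (p ^ (1 - slack δ) * d ^ (10 + δ / 2)) := by
        rw [← mul_assoc, ← rpow_add hp]; simp
    _ ≤ p ^ slack δ * ((d ^ (-(10 + δ))) ^ (1 - slack δ) * d ^ (10 + δ / 2)) := by gcongr
    _ = p ^ slack δ := by
        rw [← rpow_mul hd.le, neg_mul, h2, ← rpow_add hd]; simp

section Rates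

variable {δ ε p : ℝ} {d K J : ℕ}

lemma witnessRate_nonneg (hp : 0 < p) : 0 ≤ witnessRate d p ε := by
  unfold witnessRate; positivity

lemma eight_mul_witnessRate_le (hp : 0 < p)
    (h1 : 8 * (3 * ((d : ℝ) + 1) ^ 2) ^ (1 + ε) ≤ (d : ℝ) ^ (2 + δ / 4)) :
    8 * witnessRate d p ε ≤ p * (d : ℝ) ^ (2 + δ / 4) := by
  unfold witnessRate
  calc _ = p * (8 * (3 * ((d : ℝ) + 1) ^ 2) ^ (1 + ε)) := by ring
    _ ≤ _ := by gcongr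

lemma witnessRate_le_rpow (hδ : 0 < δ) (hp : 0 < p) (hd : 3 ≤ (d : ℝ))
    (hpd : p ≤ (d : ℝ) ^ (-(10 + δ)))
    (h1 : 8 * (3 * ((d : ℝ) + 1) ^ 2) ^ (1 + ε) ≤ (d : ℝ) ^ (2 + δ / 4)) :
    witnessRate d p ε ≤ p ^ slack δ := by
  calc witnessRate d p ε ≤ 8 * witnessRate d p ε := by
        have := witnessRate_nonneg (d := d) (ε := ε) hp; linarith
    _ ≤ p * (d : ℝ) ^ (2 + δ / 4) := eight_mul_witnessRate_le hp h1
    _ ≤ p * (d : ℝ) ^ (10 + δ / 2) := by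
        exact mul_le_mul_of_nonneg_left
          (rpow_le_rpow_of_exponent_le (by linarith) (by linarith)) hp.le
    _ ≤ p ^ slack δ := mul_rpow_le_rpow_slack hδ hp (by linarith) hpd

/-- The exponent is `8 * K + (8 * J + 11)`, and `J` is so small compared with `K` that the second
summand is at most `δ / 8 * K`. -/
lemma ballBound_le (hd : 3 ≤ (d : ℝ)) (hK : 1 ≤ K)
    (hJ : 8 * (J : ℝ) + 11 ≤ δ / 8 * K) (h2 : 3 * (2 : ℝ) ^ (8 + δ / 8) ≤ (d : ℝ) ^ (δ / 8)) :
    3 * ((d : ℝ) + 1) ^ (4 * (2 * K + 2 * J + 2) + 3) ≤ ((d : ℝ) ^ (8 + δ / 4)) ^ K := by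
  have hU : ((4 * (2 * K + 2 * J + 2) + 3 : ℕ) : ℝ) ≤ (8 + δ / 8) * K := by
    push_cast; linarith
  calc 3 * ((d : ℝ) + 1) ^ (4 * (2 * K + 2 * J + 2) + 3)
      ≤ 3 ^ K * (2 * (d : ℝ)) ^ (4 * (2 * K + 2 * J + 2) + 3) := by
        gcongr
        · exact le_self_pow₀ (by norm_num) (by omega)
        · linarith
    _ ≤ 3 ^ K * (2 * (d : ℝ)) ^ ((8 + δ / 8) * K) := by
        rw [← rpow_natCast (2 * (d : ℝ))]
        gcongr
        linarith
    _ = (3 * 2 ^ (8 + δ / 8) * (d : ℝ) ^ (8 + δ / 8)) ^ K := by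
        rw [rpow_mul (by positivity), rpow_natCast, mul_rpow (by norm_num) (by positivity),
          mul_assoc, mul_pow 3]
    _ ≤ ((d : ℝ) ^ (δ / 8) * (d : ℝ) ^ (8 + δ / 8)) ^ K := by gcongr
    _ = ((d : ℝ) ^ (8 + δ / 4)) ^ K := by
        rw [← rpow_add (by linarith)]; congr 2; ring

lemma three_mul_add_one_le_pow (hK : 1 ≤ K) : 3 * (K + 1) ≤ 8 ^ K := by
  induction K, hK using Nat.le_induction with
  | base => norm_num
  | succ K _ ih => rw [pow_succ]; omega

/-- The exponents of `d` add up: `8 + δ / 4` from the ball and `2 + δ / 4` from the witness rate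
give `10 + δ / 2`, just what the criterion can pay for. -/
lemma componentRate_le (hδ : 0 < δ) (hp : 0 < p) (hd : 3 ≤ (d : ℝ))
    (hpd : p ≤ (d : ℝ) ^ (-(10 + δ)))
    (h1 : 8 * (3 * ((d : ℝ) + 1) ^ 2) ^ (1 + ε) ≤ (d : ℝ) ^ (2 + δ / 4))
    (h2 : 3 * (2 : ℝ) ^ (8 + δ / 8) ≤ (d : ℝ) ^ (δ / 8)) (hK : 1 ≤ K) (hJK : J ≤ K)
    (hJ : 8 * (J : ℝ) + 11 ≤ δ / 8 * K) :
    3 * ((d : ℝ) + 1) ^ (4 * (2 * K + 2 * J + 2) + 3) *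
      ((J + 1) * (3 * witnessRate d p ε ^ K)) ≤ (p ^ slack δ) ^ K := by
  have hθ := witnessRate_nonneg (d := d) (ε := ε) hp
  have hq : ((J : ℝ) + 1) * (3 * witnessRate d p ε ^ K) ≤ (p * (d : ℝ) ^ (2 + δ / 4)) ^ K := by
    have h8 : 3 * ((J : ℝ) + 1) ≤ 8 ^ K := by
      have : 3 * (J + 1) ≤ 8 ^ K := le_trans (by omega) (three_mul_add_one_le_pow hK)
      exact_mod_cast this
    calc ((J : ℝ) + 1) * (3 * witnessRate d p ε ^ K)
        = 3 * ((J : ℝ) + 1) * witnessRate d p ε ^ K := by ring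
      _ ≤ 8 ^ K * witnessRate d p ε ^ K := by gcongr
      _ = (8 * witnessRate d p ε) ^ K := (mul_pow _ _ _).symm
      _ ≤ _ := pow_le_pow_left₀ (by positivity) (eight_mul_witnessRate_le hp h1) K
  calc _ ≤ ((d : ℝ) ^ (8 + δ / 4)) ^ K * (p * (d : ℝ) ^ (2 + δ / 4)) ^ K := by
        gcongr ?_ * ?_
        · exact ballBound_le hd hK hJ h2
    _ = (p * (d : ℝ) ^ (10 + δ / 2)) ^ K := by
        rw [← mul_pow]
        congr 1
        rw [mul_left_comm, ← rpow_add (by linarith)]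
        congr 2; ring
    _ ≤ (p ^ slack δ) ^ K :=
        pow_le_pow_left₀ (by positivity) (mul_rpow_le_rpow_slack hδ hp (by linarith) hpd) K

end Rates

lemma exists_large_logb {A B C' : ℝ} (hA : 0 ≤ A) (hC : 0 < C') :
    ∃ L₀ : ℝ, ∀ L, L₀ ≤ L →
      1 ≤ log L ∧ A * L < L ^ 2 ∧ C' * log L ≤ L ∧ B * L ≤ exp (L / 2) := by
  have h1 := tendsto_log_atTop.eventually_ge_atTop 1
  have h2 := isLittleO_log_id_atTop.bound (show 0 < 1 / C' by positivity)
  obtain ⟨L₀, hL₀⟩ := eventually_atTop.1 ((h1.and h2).and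
    ((eventually_gt_atTop A).and ((eventually_ge_atTop (8 * B)).and (eventually_gt_atTop 0))))
  refine ⟨L₀, fun L hL => ?_⟩
  obtain ⟨⟨h1, h2⟩, h3, h4, h5⟩ := hL₀ L hL
  refine ⟨h1, by nlinarith, ?_, ?_⟩
  · simp only [id, norm_eq_abs, abs_of_nonneg (show 0 ≤ log L by linarith), abs_of_pos h5] at h2
    rw [div_mul_eq_mul_div, one_mul, le_div_iff₀ hC] at h2
    linarith
  · have := quadratic_le_exp_of_nonneg (show 0 ≤ L / 2 by linarith)
    nlinarith

end LLLInstance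

/-! ### Choice of the parameters -/

namespace LLLInstance

open Filter Real

set_option maxHeartbeats 1000000 in
lemma exists_admissible {δ c : ℝ} (hδ : 0 < δ) (hc : 1 ≤ c) :
    ∃ C d₀ L₀ : ℝ, 0 < C ∧ ∀ (n d : ℕ) (p : ℝ), 0 < p → p < 1 → p ≤ (d : ℝ) ^ (-(10 + δ)) →
      d₀ ≤ d → L₀ ≤ logb (1 / p) n → ∃ K J M s s' k : ℕ,
        Admissible c C (slack δ / 2) (min 1 (δ / 16)) p n d K J M s s' k := by
  obtain ⟨d₀, hd₀3, hd₀⟩ := exists_large_degree hδ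
  set γ := slack δ with hγ
  have hγ0 : 0 < γ := slack_pos hδ
  have hγ1 : γ ≤ 1 := slack_le_one hδ
  set ε := min 1 (δ / 16) with hε
  have hε0 : 0 < ε := by positivity
  have hlogε : 0 < log (1 + ε) := log_pos (by linarith)
  -- With `J ≥ C₂ * ℓ`, the growth `(1 + ε) ^ J` reaches `exp (2 * ℓ) = L ^ 2`, which exceeds `M`.
  set C₂ : ℝ := 2 / log (1 + ε) with hC₂
  have hC₂0 : 0 < C₂ := by positivity
  -- The first summand gives `8 * J + 11 ≤ δ / 8 * K`, the second gives `J ≤ K`, and the third `ℓ ≤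
  -- K`.
  set C₁ : ℝ := 8 / δ * (8 * C₂ + 19) + C₂ + 1 with hC₁
  have hC₁0 : 0 < 8 / δ * (8 * C₂ + 19) := by positivity
  have hC₁1 : 1 ≤ C₁ := by rw [hC₁]; linarith
  set u : ℝ := 8 + δ / 8 with hu
  have hu0 : 0 < u := by positivity
  set A : ℝ := (c + 2) / γ + 2 with hA
  have hA0 : 0 < A := by positivity
  obtain ⟨L₀, hL₀⟩ := exists_large_logb (A := A) (B := 2 * c / γ) (C' := 4 * (C₁ + 1))
    (by positivity) (by positivity)
  set C : ℝ := (2 * (C₁ + 1) + 2 * (C₂ + 1) + 3) + (2 + (8 + δ / 4) * (C₁ + 1)) +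
    u * (A + 1) + 4 + 9 * u * (C₁ + 1) with hC
  have hCa : 0 < 2 * (C₁ + 1) + 2 * (C₂ + 1) + 3 := by positivity
  have hCb : 0 < 2 + (8 + δ / 4) * (C₁ + 1) := by positivity
  have hCc : 0 < u * (A + 1) := by positivity
  have hCd : 0 < 9 * u * (C₁ + 1) := by positivity
  refine ⟨C, d₀, L₀, by positivity, fun n d p hp hp1 hpd hd hL => ?_⟩
  obtain ⟨h1, h2⟩ := hd₀ d hd
  have hd3 : (3 : ℝ) ≤ d := hd₀3.trans hd
  have hd1 : (1 : ℝ) ≤ d := by linarith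
  obtain ⟨hℓ1, hAL, hℓL, hexp⟩ := hL₀ _ hL
  set L := logb (1 / p) n with hLdef
  set ℓ := log L with hℓ
  have hℓ0 : 0 < ℓ := zero_lt_one.trans_le hℓ1
  have hL0 : 0 < L := by
    have : 0 < 4 * (C₁ + 1) * ℓ := by positivity
    exact this.trans_le hℓL
  have hLexp : L ^ 2 = exp (2 * ℓ) := by
    rw [mul_comm, exp_mul, exp_log hL0]; norm_num
  have hL1 : 1 ≤ L := by
    have := add_one_le_exp ℓ
    rw [exp_log hL0] at this
    linarith
  have hn0 : 0 < (n : ℝ) := by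
    rcases Nat.eq_zero_or_pos n with h | h
    · simp [hLdef, h] at hL0
    · exact_mod_cast h
  have hn : (n : ℝ) = p ^ (-L) := by
    rw [rpow_neg hp.le, ← inv_rpow hp.le, ← one_div, hLdef, rpow_logb (by positivity) _ hn0]
    exact ((one_lt_div hp).2 hp1).ne'
  have hnc : (n : ℝ) ^ (-c) = p ^ (c * L) := by
    rw [hn, ← rpow_mul hp.le]; congr 1; ring
  have hp3 : p ≤ 1 / 3 := by
    calc p ≤ (d : ℝ) ^ (-(10 + δ)) := hpd
      _ ≤ (d : ℝ) ^ (-1 : ℝ) := rpow_le_rpow_of_exponent_le hd1 (by linarith)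
      _ = 1 / d := by rw [rpow_neg_one, one_div]
      _ ≤ 1 / 3 := by gcongr
  set K := ⌈C₁ * ℓ⌉₊ with hK
  set J := ⌈C₂ * ℓ⌉₊ with hJ
  -- In powers of `p`: `L` for the union over `n` events, `c * L` for the failure probability and
  -- `1` for the factor `3 ≤ 1 / p`.
  set M := ⌈((c + 1) * L + 1) / γ⌉₊ with hM
  -- Each member of a component gains `p ^ (γ * K)`, so `s` members with `K * s ≥ M` suffice.
  set s := M / K + 1 with hs
  set R := 2 * K + 2 * J + 2 with hR
  have hKlo : C₁ * ℓ ≤ K := Nat.le_ceil _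
  have hKhi : K ≤ (C₁ + 1) * ℓ := by
    have := (Nat.ceil_lt_add_one (show 0 ≤ C₁ * ℓ by positivity)).le
    linarith
  have hℓK : ℓ ≤ K := (le_mul_of_one_le_left hℓ0.le hC₁1).trans hKlo
  have hK1 : 1 ≤ K := by
    have : (1 : ℝ) ≤ K := hℓ1.trans hℓK
    exact_mod_cast this
  have hJlo : C₂ * ℓ ≤ J := Nat.le_ceil _
  have hJhi : J ≤ (C₂ + 1) * ℓ := by
    have := (Nat.ceil_lt_add_one (show 0 ≤ C₂ * ℓ by positivity)).le
    linarith
  have hJK : J ≤ K := Nat.ceil_mono (mul_le_mul_of_nonneg_right (by rw [hC₁]; linarith) hℓ0.le)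
  have hJδ : 8 * (J : ℝ) + 11 ≤ δ / 8 * K := by
    have e1 : δ / 8 * (8 / δ * (8 * C₂ + 19)) = 8 * C₂ + 19 := by field_simp
    calc 8 * (J : ℝ) + 11 ≤ (8 * C₂ + 19) * ℓ := by linarith
      _ = δ / 8 * (8 / δ * (8 * C₂ + 19)) * ℓ := by rw [e1]
      _ = δ / 8 * (8 / δ * (8 * C₂ + 19) * ℓ) := by ring
      _ ≤ δ / 8 * K := by
        gcongr
        refine le_trans ?_ hKlo
        gcongr
        linarith
  have hMlo : (c + 1) * L + 1 ≤ γ * M := by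
    have : ((c + 1) * L + 1) / γ ≤ M := Nat.le_ceil _
    rwa [div_le_iff₀' hγ0] at this
  have hMhi : (M : ℝ) + 1 ≤ A * L := by
    have h3 := (Nat.ceil_lt_add_one (show 0 ≤ ((c + 1) * L + 1) / γ by positivity)).le
    have h4 : ((c + 1) * L + 1) / γ ≤ (c + 2) / γ * L := by
      rw [div_mul_eq_mul_div]; gcongr; linarith
    rw [hA, add_mul]
    linarith
  have h4K : 4 * (K : ℝ) ≤ L := by linarith
  have hU : ((4 * R + 3 : ℕ) : ℝ) ≤ u * K := by
    simp only [hR, hu]; push_cast; linarith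
  have hpγ : p ^ γ ≤ 1 := rpow_le_one hp.le hp1.le hγ0.le
  have hpγ0 : 0 ≤ p ^ γ := by positivity
  have hθ0 : 0 ≤ witnessRate d p ε := witnessRate_nonneg hp
  have hθ : witnessRate d p ε ≤ p ^ γ := witnessRate_le_rpow hδ hp hd3 hpd h1
  have hX := componentRate_le hδ hp hd3 hpd h1 h2 hK1 hJK hJδ
  set q := ((J : ℝ) + 1) * (3 * witnessRate d p ε ^ K) with hq
  have hq0 : 0 ≤ q := by positivity
  have hwhp : n * (3 * (p ^ γ) ^ M) ≤ (n : ℝ) ^ (-c) := by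
    have h3 : (3 : ℝ) ≤ p ^ (-1 : ℝ) := by
      rw [rpow_neg_one, le_inv_comm₀ (by norm_num) hp]; linarith
    rw [hnc, ← rpow_natCast (p ^ γ), ← rpow_mul hp.le]
    calc (n : ℝ) * (3 * p ^ (γ * M)) ≤ p ^ (-L) * (p ^ (-1 : ℝ) * p ^ (γ * M)) := by
          rw [hn]; gcongr
      _ = p ^ (-L + (-1 + γ * M)) := by rw [← rpow_add hp, ← rpow_add hp]
      _ ≤ p ^ (c * L) := rpow_le_rpow_of_exponent_ge hp hp1.le (by linarith)
  have hKs : M ≤ K * s := by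
    have := Nat.div_add_mod M K
    have := Nat.mod_lt M hK1
    rw [hs, mul_add]; omega
  have hsM : (s : ℝ) ≤ M + 1 := by
    have : s ≤ M + 1 := Nat.succ_le_succ (Nat.div_le_self M K)
    exact_mod_cast this
  have hsL : (s : ℝ) < exp (2 * ℓ) := by rw [← hLexp]; linarith
  have hball := ballBound_le hd3 hK1 hJδ h2
  set V : ℝ := ((d : ℝ) + 1) ^ (2 * R + 1) with hV
  have hV0 : 0 < V := by positivity
  have hVU : 2 * d * V ≤ ((d : ℝ) + 1) ^ (4 * R + 3) := by
    calc 2 * d * V ≤ ((d : ℝ) + 1) ^ 2 * ((d : ℝ) + 1) ^ (2 * R + 1) := by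
          rw [hV]; gcongr; nlinarith only [sq_nonneg (d : ℝ)]
      _ = ((d : ℝ) + 1) ^ (2 * R + 3) := by rw [← pow_add]; congr 1; ring
      _ ≤ _ := pow_le_pow_right₀ (by linarith) (by omega)
  set N : ℝ := n * p ^ (γ / 2 * ℓ) with hN
  have hN0 : 0 < N := by positivity
  -- The largest number of separated events that `number_le` allows; `s'` is its integer part. It is
  -- at least `2 * exp (L / 2)`, so the exponent `s'` in `separated_le` beats `c * L`.
  set y : ℝ := N / (d * V) with hy
  have hdV0 : 0 < d * V := by positivity
  have hyp : 2 * p ^ (-(L / 2)) ≤ y := by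
    rw [hy, le_div_iff₀ hdV0]
    have e1 : 2 * (d * V) ≤ p ^ (-(K : ℝ)) := by
      calc 2 * (d * V) = 2 * d * V := by ring
        _ ≤ ((d : ℝ) + 1) ^ (4 * R + 3) := hVU
        _ ≤ 3 * ((d : ℝ) + 1) ^ (4 * R + 3) := by
          have : 0 ≤ ((d : ℝ) + 1) ^ (4 * R + 3) := by positivity
          linarith
        _ ≤ ((d : ℝ) ^ (8 + δ / 4)) ^ K := hball
        _ ≤ ((d : ℝ) ^ (10 + δ)) ^ K := by
          refine pow_le_pow_left₀ (by positivity) ?_ K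
          exact rpow_le_rpow_of_exponent_le hd1 (by linarith)
        _ ≤ (p⁻¹) ^ K := by
          refine pow_le_pow_left₀ (by positivity) ?_ K
          rw [le_inv_comm₀ (by positivity) hp, ← rpow_neg (by positivity)]
          exact hpd
        _ = p ^ (-(K : ℝ)) := by rw [rpow_neg hp.le, rpow_natCast, inv_pow]
    calc 2 * p ^ (-(L / 2)) * (d * V) = p ^ (-(L / 2)) * (2 * (d * V)) := by ring
      _ ≤ p ^ (-(L / 2)) * p ^ (-(K : ℝ)) := by gcongr
      _ = p ^ (-(L / 2) + -(K : ℝ)) := (rpow_add hp _ _).symm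
      _ ≤ p ^ (-L + γ / 2 * ℓ) := by
        refine rpow_le_rpow_of_exponent_ge hp hp1.le ?_
        have : γ / 2 * ℓ ≤ 1 * K := by gcongr; linarith
        linarith
      _ = N := by rw [rpow_add hp, hN, hn]
  have hexpp : exp (L / 2) ≤ p ^ (-(L / 2)) := by
    have h3 : exp 1 ≤ p⁻¹ := by
      rw [le_inv_comm₀ (exp_pos 1) hp]
      refine hp3.trans ?_
      rw [one_div]
      have := exp_one_lt_d9
      gcongr
      linarith
    rw [rpow_neg hp.le, ← inv_rpow hp.le, ← one_mul (L / 2), exp_mul, one_mul]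
    gcongr
  have hy2 : 2 ≤ y := by
    have : 1 ≤ exp (L / 2) := one_le_exp (by linarith)
    linarith
  set s' := ⌊y⌋₊ with hs'
  have hs'y : (s' : ℝ) ≤ y := Nat.floor_le (by linarith)
  have hys' : y / 2 ≤ s' := by
    have := Nat.lt_floor_add_one y
    linarith
  have hs'0 : (0 : ℝ) < s' := by linarith
  have hKs' : c * L ≤ γ / 2 * s' := by
    have : 2 * c / γ * L ≤ s' := by linarith
    rw [div_mul_eq_mul_div, div_le_iff₀ hγ0] at this
    linarith
  -- Since `s < exp (2 * ℓ)` and `2 < 3 * log 2`, this gives `s < 2 ^ k`.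
  set k := ⌈3 * ℓ⌉₊ with hk
  have hklo : 3 * ℓ ≤ k := Nat.le_ceil _
  have hkhi : k ≤ 4 * ℓ := by
    have := (Nat.ceil_lt_add_one (show 0 ≤ 3 * ℓ by positivity)).le
    linarith
  have hCℓ : ∀ a : ℝ, a ≤ C → a * ℓ ≤ C * ℓ := fun a ha => by gcongr
  refine ⟨K, J, M, s, s', k, ?_⟩
  constructor
  case one_le_d => exact_mod_cast hd1
  case one_le_K => exact hK1
  case one_le_s' => exact_mod_cast hs'0
  case one_le_k =>
    have : (0 : ℝ) < k := by linarith
    exact_mod_cast this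
  case eps_nonneg => exact hε0.le
  case lt_pow =>
    calc (M : ℝ) < L ^ 2 := by linarith
      _ = exp (2 * ℓ) := hLexp
      _ = (1 + ε) ^ (C₂ * ℓ) := by
        rw [rpow_def_of_pos (by linarith), hC₂]; congr 1; field_simp
      _ ≤ (1 + ε) ^ (J : ℝ) := rpow_le_rpow_of_exponent_le (by linarith) hJlo
      _ = _ := rpow_natCast _ _
  case rate_le => exact hθ.trans hpγ
  case witness_le =>
    refine le_trans ?_ hwhp
    gcongr n * (3 * ?_)
    calc witnessRate d p ε ^ (M + 1) ≤ (p ^ γ) ^ (M + 1) := pow_le_pow_left₀ hθ0 hθ _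
      _ ≤ (p ^ γ) ^ M := pow_le_pow_of_le_one hpγ0 hpγ (Nat.le_succ M)
  case component_rate_le => exact hX.trans (pow_le_one₀ hpγ0 hpγ)
  case component_le =>
    refine le_trans ?_ hwhp
    gcongr n * (3 * ?_)
    calc _ ≤ ((p ^ γ) ^ K) ^ s := pow_le_pow_left₀ (by positivity) hX _
      _ = (p ^ γ) ^ (K * s) := (pow_mul _ _ _).symm
      _ ≤ (p ^ γ) ^ M := pow_le_pow_of_le_one hpγ0 hpγ hKs
  case separated_le =>
    -- In `n / s'` the factor `n` cancels against `N`, leaving `2 * d * V`, which the ball of radius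
    -- `4 * R + 3` dominates; the remaining exponent `γ * K - γ / 2 * ℓ` is at least `γ / 2`.
    have hbase : 3 * n * q / s' ≤ p ^ (γ / 2) := by
      have e1 : 3 * n * q / s' ≤ 3 * n * q / (y / 2) := by gcongr
      have e2 : 3 * n * q / (y / 2) = 3 * (2 * d * V) * q * p ^ (-(γ / 2 * ℓ)) := by
        rw [hy, hN, rpow_neg hp.le]
        field_simp
      calc _ ≤ 3 * (2 * d * V) * q * p ^ (-(γ / 2 * ℓ)) := e1.trans e2.le
        _ ≤ 3 * ((d : ℝ) + 1) ^ (4 * R + 3) * q * p ^ (-(γ / 2 * ℓ)) := by gcongr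
        _ ≤ (p ^ γ) ^ K * p ^ (-(γ / 2 * ℓ)) := by gcongr
        _ = p ^ (γ * K + -(γ / 2 * ℓ)) := by
          rw [rpow_add hp, rpow_mul hp.le, rpow_natCast]
        _ ≤ p ^ (γ / 2) := by
          refine rpow_le_rpow_of_exponent_ge hp hp1.le ?_
          have h3 : γ / 2 * ℓ ≤ γ / 2 * K := by gcongr
          have h4 : γ / 2 * 1 ≤ γ / 2 * K := by gcongr; linarith
          linarith
    calc (3 * n * q / s') ^ s' ≤ (p ^ (γ / 2)) ^ s' := pow_le_pow_left₀ (by positivity) hbase _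
      _ = p ^ (γ / 2 * s') := by rw [← rpow_natCast, ← rpow_mul hp.le]
      _ ≤ p ^ (c * L) := rpow_le_rpow_of_exponent_ge hp hp1.le hKs'
      _ = _ := hnc.symm
  case number_le =>
    calc s' * V * d ≤ y * V * d := by gcongr
      _ = N := by rw [hy]; field_simp
  case radius_le =>
    refine Nat.le_floor ?_
    push_cast
    calc 2 * (K : ℝ) + 2 * J + 3 ≤ (2 * (C₁ + 1) + 2 * (C₂ + 1) + 3) * ℓ := by linarith
      _ ≤ C * ℓ := hCℓ _ (by rw [hC]; linarith)
  case size_le =>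
    have hde : exp 1 ≤ d := by
      have := exp_one_lt_d9
      linarith
    have e1 : exp (2 * ℓ) ≤ (d : ℝ) ^ (2 * ℓ) := by
      rw [← one_mul (2 * ℓ), exp_mul, one_mul]
      gcongr
    have e2 : V ≤ (d : ℝ) ^ ((8 + δ / 4) * (C₁ + 1) * ℓ) := by
      calc V ≤ ((d : ℝ) + 1) ^ (4 * R + 3) := pow_le_pow_right₀ (by linarith) (by omega)
        _ ≤ 3 * ((d : ℝ) + 1) ^ (4 * R + 3) := by
          have : 0 ≤ ((d : ℝ) + 1) ^ (4 * R + 3) := by positivity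
          linarith
        _ ≤ ((d : ℝ) ^ (8 + δ / 4)) ^ K := hball
        _ = (d : ℝ) ^ ((8 + δ / 4) * K) := by rw [rpow_mul (by positivity), rpow_natCast]
        _ ≤ _ := by
          refine rpow_le_rpow_of_exponent_le hd1 ?_
          rw [mul_assoc]
          gcongr
    calc s * V ≤ (d : ℝ) ^ (2 * ℓ) * (d : ℝ) ^ ((8 + δ / 4) * (C₁ + 1) * ℓ) := by
          gcongr
          exact hsL.le.trans e1
      _ = (d : ℝ) ^ ((2 + (8 + δ / 4) * (C₁ + 1)) * ℓ) := by
          rw [← rpow_add (by linarith)]; congr 1; ring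
      _ ≤ (d : ℝ) ^ (C * ℓ) :=
          rpow_le_rpow_of_exponent_le hd1 (hCℓ _ (by rw [hC]; linarith))
  case diam_le =>
    refine Nat.le_floor ?_
    have hMK : ((M / K : ℕ) : ℝ) * K ≤ M := by exact_mod_cast Nat.div_mul_le_self M K
    have h3 : 2 * (2 * R + 1) ≤ 4 * R + 3 := by omega
    calc ((s * (4 * R + 3) + 2 * (2 * R + 1) : ℕ) : ℝ)
        ≤ ((s * (4 * R + 3) + (4 * R + 3) : ℕ) : ℝ) := by exact_mod_cast Nat.add_le_add_left h3 _
      _ = ((M / K : ℕ) + 2) * ((4 * R + 3 : ℕ) : ℝ) := by rw [hs]; push_cast; ring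
      _ ≤ ((M / K : ℕ) + 2) * (u * K) := by gcongr
      _ = u * (((M / K : ℕ) : ℝ) * K + 2 * K) := by ring
      _ ≤ u * (A * L + L) := mul_le_mul_of_nonneg_left (by linarith) hu0.le
      _ = u * (A + 1) * L := by ring
      _ ≤ C * L := by gcongr; rw [hC]; linarith
  case s_lt =>
    have hlog2 := log_two_gt_d9
    have : (s : ℝ) < 2 ^ k := by
      calc (s : ℝ) < exp (2 * ℓ) := hsL
        _ ≤ exp (log 2 * (3 * ℓ)) := exp_le_exp.2 (by nlinarith only [hlog2, hℓ0])
        _ = 2 ^ (3 * ℓ) := (rpow_def_of_pos (by norm_num) _).symm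
        _ ≤ 2 ^ (k : ℝ) := rpow_le_rpow_of_exponent_le (by norm_num) hklo
        _ = 2 ^ k := rpow_natCast _ _
    exact_mod_cast this
  case k_le =>
    refine Nat.le_floor (hkhi.trans (hCℓ 4 ?_))
    rw [hC]; linarith
  case cluster_le =>
    refine Nat.le_floor ?_
    have h3 : 2 * (2 * R + 1) ≤ 4 * R + 3 := by omega
    calc ((2 * k * (4 * R + 3) + 2 * (2 * R + 1) : ℕ) : ℝ)
        ≤ ((2 * k * (4 * R + 3) + (4 * R + 3) : ℕ) : ℝ) := by
          exact_mod_cast Nat.add_le_add_left h3 _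
      _ = (2 * k + 1) * ((4 * R + 3 : ℕ) : ℝ) := by push_cast; ring
      _ ≤ (9 * ℓ) * (u * ((C₁ + 1) * ℓ)) := by
          gcongr
          · linarith
          · exact hU.trans (by gcongr)
      _ = 9 * u * (C₁ + 1) * ℓ ^ 2 := by ring
      _ ≤ C * ℓ ^ 2 := by gcongr; rw [hC]; linarith

end LLLInstance

/-! ### The main theorem -/

/-- A fixed power of `p` with exponent proportional to `log (log_{1/p} n)` tends to zero. -/
lemma mul_rpow_log_logb_le {δ κ : ℝ} (hδ : 0 < δ) (hκ : 0 < κ) {η : ℝ} (hη : 0 < η) :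
    ∃ d₁ L₁ : ℝ, ∀ (n d : ℕ) (p : ℝ), 0 < p → p < 1 → p ≤ (d : ℝ) ^ (-(10 + δ)) → d₁ ≤ d →
      L₁ ≤ Real.logb (1 / p) n →
      (n : ℝ) * p ^ (κ * Real.log (Real.logb (1 / p) n)) ≤ η * n := by
  obtain ⟨x₀, hx₀⟩ := Filter.eventually_atTop.1
    ((tendsto_rpow_atTop_of_base_lt_one (1 / 2 : ℝ) (by norm_num) (by norm_num)).eventually_le_const
      hη)
  obtain ⟨L₁, hL₁⟩ := Filter.eventually_atTop.1
    (Real.tendsto_log_atTop.eventually_ge_atTop (max 0 (x₀ / κ)))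
  refine ⟨2, L₁, fun n d p hp hp1 hpd hd hL => ?_⟩
  have hℓ := hL₁ _ hL
  have hp2 : p ≤ 1 / 2 := by
    calc p ≤ (d : ℝ) ^ (-(10 + δ)) := hpd
      _ ≤ (d : ℝ) ^ (-1 : ℝ) := Real.rpow_le_rpow_of_exponent_le (by linarith) (by linarith)
      _ = 1 / d := by rw [Real.rpow_neg_one, one_div]
      _ ≤ 1 / 2 := by gcongr
  have h0 : 0 ≤ κ * Real.log (Real.logb (1 / p) n) :=
    mul_nonneg hκ.le ((le_max_left _ _).trans hℓ)
  have hx : x₀ ≤ κ * Real.log (Real.logb (1 / p) n) :=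
    (div_le_iff₀' hκ).1 ((le_max_right _ _).trans hℓ)
  rw [mul_comm η]
  gcongr
  exact (Real.rpow_le_rpow hp.le hp2 h0).trans (hx₀ _ hx)

theorem lemma1 (δ : ℝ) (hδ : 0 < δ) (c : ℝ) (hc : 1 ≤ c) :
    ∃ C κ d₀ L₀ : ℝ, 0 < C ∧ 0 < κ ∧
      -- the bound `n * p ^ (κ * log (log_{1/p} n))` below is `o(n)`
      (∀ η : ℝ, 0 < η → ∃ d₁ L₁ : ℝ, ∀ (n d : ℕ) (p : ℝ), 0 < p → p < 1 →
        p ≤ (d : ℝ) ^ (-(10 + δ)) → d₁ ≤ d → L₁ ≤ Real.logb (1 / p) n →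
        (n : ℝ) * p ^ (κ * Real.log (Real.logb (1 / p) n)) ≤ η * n) ∧
      ∀ (S : Type u) [MeasurableSpace S] (n d : ℕ) (p : ℝ), 0 < p → p < 1 →
        p ≤ (d : ℝ) ^ (-(10 + δ)) → d₀ ≤ d → L₀ ≤ Real.logb (1 / p) n →
        ∃ insecure : EventProperty.{u, v, w} S,
          insecure.IsLocal ⌊C * Real.log (Real.logb (1 / p) n)⌋₊ ∧
          ∀ I : LLLInstance.{u, v, w} S, I.HasParams n d p →
            -- the variables of secure events are fixed early
            I.Whp c (fun ω => ∀ e, ¬ insecure I ω e →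
              LLLInstance.FixedAfter ω ⌊C * Real.log (Real.logb (1 / p) n)⌋₊ e) ∧
            -- the number of nodes and edges of the induced graph of insecure events
            I.Whp c (fun ω =>
              ({e | insecure I ω e}.ncard : ℝ) ≤
                n * p ^ (κ * Real.log (Real.logb (1 / p) n)) ∧
              ((I.graph.induce {e | insecure I ω e}).edgeSet.ncard : ℝ) ≤
                n * p ^ (κ * Real.log (Real.logb (1 / p) n))) ∧
            -- size and diameter of its connected components
            I.Whp c (fun ω =>
              ∀ K : (I.graph.induce {e | insecure I ω e}).ConnectedComponent,
                (K.supp.ncard : ℝ) ≤ (d : ℝ) ^ (C * Real.log (Real.logb (1 / p) n)) ∧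
                ∀ e ∈ K.supp, ∀ f ∈ K.supp,
                  I.graph.edist e.1 f.1 ≤ (⌊C * Real.logb (1 / p) n⌋₊ : ℕ)) ∧
            -- network decomposition
            I.Whp c (fun ω =>
              HasNetworkDecomposition I.graph {e | insecure I ω e}
                ⌊C * Real.log (Real.logb (1 / p) n)⌋₊
                ⌊C * Real.log (Real.logb (1 / p) n) ^ 2⌋₊) := by
  obtain ⟨C, d₀, L₀, hC, H⟩ := LLLInstance.exists_admissible hδ hc
  have hκ : 0 < LLLInstance.slack δ / 2 := half_pos (LLLInstance.slack_pos hδ)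
  refine ⟨C, LLLInstance.slack δ / 2, d₀, L₀, hC, hκ,
    fun η hη => mul_rpow_log_logb_le hδ hκ hη, fun S _ n d p hp hp1 hpd hd hL => ?_⟩
  -- The parameters depend only on `n`, `d`, `p` and the constants, so one property serves all
  -- instances.
  obtain ⟨K, J, M, s, s', k, hA⟩ := H n d p hp hp1 hpd hd hL
  exact ⟨LLLInstance.Insecure K J (M + 1) (min 1 (δ / 16)), isLocal_insecure hA.radius_le,
    fun I hI => ⟨hA.whp_fixedAfter hp hI, hA.whp_card hp hI, hA.whp_component hp hI,
      hA.whp_hasNetworkDecomposition hp hI⟩⟩
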